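/- Let $p$ be an odd prime, $K$ a field of characteristic $p$, and $G$ a cyclic group of order $q=p^\alpha$. Up to isomorphism there is, for each $1\le i\le q$, exactly one indecomposable $KG$-module $V_i$ of dimension $i$, and these are all the indecomposable $KG$-modules. For $1\le m\le n\le q$ the module $V_m\otimes_K V_n$ (with diagonal $G$-action) decomposes as $V_{\lambda_1}\oplus\dots\oplus V_{\lambda_m}$ with $\lambda_1\ge\dots\ge\lambda_m>0$, and the Jordan partition $\lambda(m,n,p)=(\lambda_1,\dots,\lambda_m)$ depends only on $m,n,p$. It is called standard if $\lambda_i=m+n-2i+1$ for all $1\le i\le m$. Theorem 2. Suppose that $p^t\le m<p^{t+1}$ with $t\ge 1$, and that $n\ge m$. Then $\lambda(m,n,p)$ is standard if and only if $$(m,n)=\Bigl(ip^t+\tfrac{p^t+\varepsilon}{2},\ jp^t+\tfrac{p^t+\varepsilon'}{2}+kp^{t+1}\Bigr)$$ for some signs $\varepsilon,\varepsilon'\in\{1,-1\}$ (chosen independently) and integers $i,j,k$ with $1\le i\le (p-1)/2$, $i\le j\le p-i-1$ and $k\ge 0$. -/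

import Mathlib

open scoped TensorProduct

noncomputable section

namespace JordanPartition

universe u v w w'

variable {K : Type u} {G : Type v} [Field K] [Group G]
variable {V : Type w} {W : Type w'} [AddCommGroup V] [Module K V] [AddCommGroup W] [Module K W]

/-- A `KG`-module is indecomposable if it is nonzero and is not the direct sum of two nonzero
`KG`-submodules. -/
def IsIndecomposable (ρ : Representation K G V) : Prop :=
  Nontrivial V ∧ ∀ A B : Subrepresentation ρ, IsCompl A B → A = ⊥ ∨ B = ⊥

/-- The `KG`-module `ρ` is an (internal) direct sum of indecomposable `KG`-submodules whose
dimensions are the entries of the list `l`. -/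
def HasDecomposition (ρ : Representation K G V) (l : List ℕ) : Prop :=
  ∃ U : Fin l.length → Subrepresentation ρ,
    DirectSum.IsInternal (fun i => (U i).toSubmodule) ∧
    ∀ i, IsIndecomposable (U i).toRepresentation ∧
      Module.finrank K (U i).toSubmodule = l.get i

open Classical in
/-- The nonincreasing list of the dimensions of the indecomposable summands of `ρ`. For a
finite-dimensional `ρ` it exists, and it is unique by the Krull-Schmidt theorem; the value `[]`
in the other branch is a default. -/
def indecomposableDims (ρ : Representation K G V) : List ℕ :=
  if h : ∃ l : List ℕ, l.SortedGE ∧ HasDecomposition ρ l then h.choose else []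

/-- The Jordan partition of the tensor product of two `KG`-modules: if `G` is a cyclic `p`-group,
`K` has characteristic `p`, and `ρ`, `σ` are indecomposable of dimensions `m ≤ n`, this is
`λ(m, n, p) = (λ₁, …, λₘ)`, where `ρ ⊗ σ` is the direct sum of indecomposable modules
of dimensions `λ₁ ≥ … ≥ λₘ`. -/
def jordanPartition (ρ : Representation K G V) (σ : Representation K G W) : List ℕ :=
  indecomposableDims (ρ.tprod σ)

/-- The list `l = (λ₁, …, λₘ)` is standard for `(m, n)`: it has `m` entries and
`λᵢ = m + n - 2 i + 1` for `1 ≤ i ≤ m` (the entry `λᵢ` is `l[i - 1]`). -/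
def IsStandard (m n : ℕ) (l : List ℕ) : Prop :=
  l.length = m ∧
    ∀ (i : ℕ) (hi : i < l.length), (l[i] : ℤ) = (m : ℤ) + n - 2 * ((i : ℤ) + 1) + 1

/-- The set of pairs `(i p^t + (p^t ± 1)/2, j p^t + (p^t ± 1)/2 + k p^(t+1))` with
`1 ≤ i ≤ (p - 1)/2`, `i ≤ j ≤ p - i - 1`, `k ≥ 0`; the two signs are independent.
(For odd `p` the divisions by two are exact.) -/
def standardPairs (p t : ℕ) : Set (ℕ × ℕ) :=
  {x | ∃ i j k c d : ℕ, 1 ≤ i ∧ i ≤ (p - 1) / 2 ∧ i ≤ j ∧ j ≤ p - i - 1 ∧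
    (c = (p ^ t - 1) / 2 ∨ c = (p ^ t + 1) / 2) ∧
    (d = (p ^ t - 1) / 2 ∨ d = (p ^ t + 1) / 2) ∧
    x = (i * p ^ t + c, j * p ^ t + d + k * p ^ (t + 1))}

end JordanPartition

end

open scoped TensorProduct

namespace JordanPartition

/-! Let `g` generate `G`. Each factor is a single Jordan block of the nilpotent `g - 1`, so the
tensor product is `K[x, y] / (x ^ m, y ^ n)` with `g - 1` acting as `x + y + x y`. Replacing `x` by
`x (1 + y)` (`IsBicyclic.twist`) makes this the homogeneous element `x + y`.

For `1 ≤ r ≤ m`, multiplication by `(x + y) ^ (m + n - 2 r)` maps degree `r - 1` to degree `m + n -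
r - 1`, both of dimension `r`, with matrix `boxMatrix r (m - r) (n - r)` in suitable bases. The
partition is standard iff all these maps are bijective. Bijectivity puts an explicit kernel vector
of `x + y` at the end of a chain of length `m + n - 2 r + 1` (`IsBicyclic.exists_isJordanBasis`); a
singular map pushes the rank of the power below the standard value `r ^ 2`
(`IsBicyclic.finrank_range_lt`).

The determinants are MacMahon's box numbers (`det_boxMatrix_mul`). By Legendre's formula their
`p`-adic valuation is the sum over `e ≥ 1` of the nonnegative numbers `boxExcess (p ^ e)`, so
standardness means that all of these vanish. Some excess for `q` is positive once `(m, n)` lies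
within taxicab distance `< q - 1` of a point `(u q, v q)` with `u, v ≥ 1`. For `q = p ^ t` avoiding
this forces the residues `(q ± 1) / 2`; for `q = p ^ (t + 1)` it gives `i ≤ j ≤ p - i - 1`.
Conversely these conditions kill the excess for every power of `p` (`forall_boxExcess_eq_zero_iff`).
-/

/-! ### Arithmetic of the box exponents -/

/-- The sum of the quotients `j / q` over `j < n`. -/
def sumDiv (q n : ℕ) : ℕ := ∑ j ∈ Finset.range n, j / q

lemma sum_range_add_div (q x r : ℕ) :
    (∑ j ∈ Finset.range r, (x + j) / q) + sumDiv q x = sumDiv q (x + r) := by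
  rw [sumDiv, sumDiv, Finset.sum_range_add, add_comm]

lemma sumDiv_of_le {q x : ℕ} (h : x ≤ q) : sumDiv q x = 0 :=
  Finset.sum_eq_zero fun _ hj => Nat.div_eq_of_lt (lt_of_lt_of_le (Finset.mem_range.1 hj) h)

lemma sumDiv_add_self {q : ℕ} (hq : 0 < q) (x : ℕ) : sumDiv q (x + q) = sumDiv q x + x := by
  rw [add_comm x q, ← sum_range_add_div q q x, sumDiv_of_le le_rfl]
  simp [Nat.add_div_left _ hq, Finset.sum_add_distrib, sumDiv]

/-- The range `3 * q` is enough for a sum of three residues. -/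
lemma sumDiv_of_lt {q x : ℕ} (h : x < 3 * q) : sumDiv q x = (x - q) + (x - 2 * q) := by
  have hq : 0 < q := by omega
  rcases le_or_gt x q with h1 | h1
  · rw [sumDiv_of_le h1]; omega
  obtain ⟨y, rfl⟩ : ∃ y, x = y + q := ⟨x - q, by omega⟩
  rw [sumDiv_add_self hq]
  rcases le_or_gt y q with h2 | h2
  · rw [sumDiv_of_le h2]; omega
  obtain ⟨z, rfl⟩ : ∃ z, y = z + q := ⟨y - q, by omega⟩
  rw [sumDiv_add_self hq, sumDiv_of_le (by omega)]
  omega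

/-- The contribution of `q = p ^ e` to the `p`-adic valuation of the number of plane partitions
in an `r × b × c` box. -/
def boxExcess (q r b c : ℕ) : ℤ :=
  sumDiv q (b + c + r) + sumDiv q r + sumDiv q b + sumDiv q c
    - sumDiv q (b + c) - sumDiv q (b + r) - sumDiv q (c + r)

lemma boxExcess_comm (q r b c : ℕ) : boxExcess q r b c = boxExcess q b r c := by
  unfold boxExcess
  rw [show b + c + r = r + c + b by ring, show b + c = c + b by ring, show c + r = r + c by ring,
    show b + r = r + b by ring]
  ring

lemma boxExcess_comm' (q r b c : ℕ) : boxExcess q r b c = boxExcess q r c b := by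
  unfold boxExcess
  rw [add_comm b c]
  ring

lemma boxExcess_add_self {q : ℕ} (hq : 0 < q) (r b c : ℕ) :
    boxExcess q (r + q) b c = boxExcess q r b c := by
  unfold boxExcess
  simp only [← add_assoc, sumDiv_add_self hq]
  push_cast
  ring

lemma boxExcess_add_mul {q : ℕ} (hq : 0 < q) (r b c k : ℕ) :
    boxExcess q (r + q * k) b c = boxExcess q r b c := by
  induction k with
  | zero => simp
  | succ k ih => rw [mul_add, mul_one, ← add_assoc, boxExcess_add_self hq, ih]

lemma boxExcess_mod {q : ℕ} (hq : 0 < q) (r b c : ℕ) :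
    boxExcess q r b c = boxExcess q (r % q) (b % q) (c % q) := by
  have key : ∀ r b c, boxExcess q r b c = boxExcess q (r % q) b c := fun r b c => by
    conv_lhs => rw [← Nat.mod_add_div r q, boxExcess_add_mul hq]
  rw [key, boxExcess_comm, key, boxExcess_comm, boxExcess_comm', boxExcess_comm, key,
    boxExcess_comm, boxExcess_comm']

lemma boxExcess_of_lt {q r b c : ℕ} (hr : r < q) (hb : b < q) (hc : c < q) :
    boxExcess q r b c = ((b + c + r - q + (b + c + r - 2 * q) : ℕ) : ℤ)
      - (b + c - q : ℕ) - (b + r - q : ℕ) - (c + r - q : ℕ) := by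
  unfold boxExcess
  rw [sumDiv_of_lt (x := b + c + r) (by omega), sumDiv_of_lt (x := b + c) (by omega),
    sumDiv_of_lt (x := b + r) (by omega), sumDiv_of_lt (x := c + r) (by omega),
    sumDiv_of_le hr.le, sumDiv_of_le hb.le, sumDiv_of_le hc.le]
  omega

lemma boxExcess_nonneg {q : ℕ} (hq : 0 < q) (r b c : ℕ) : 0 ≤ boxExcess q r b c := by
  have hr := Nat.mod_lt r hq
  have hb := Nat.mod_lt b hq
  have hc := Nat.mod_lt c hq
  rw [boxExcess_mod hq, boxExcess_of_lt hr hb hc]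
  omega

lemma boxExcess_eq_zero_of_lt {q r b c : ℕ} (h : r + b + c ≤ q) : boxExcess q r b c = 0 := by
  unfold boxExcess
  rw [sumDiv_of_le, sumDiv_of_le, sumDiv_of_le, sumDiv_of_le, sumDiv_of_le, sumDiv_of_le,
    sumDiv_of_le] <;> omega

lemma add_mod_cases {q : ℕ} (hq : 0 < q) (x y : ℕ) :
    x % q + y % q = (x + y) % q ∨ x % q + y % q = (x + y) % q + q := by
  have h1 := Nat.mod_lt x hq
  have h2 := Nat.mod_lt y hq
  rw [Nat.add_mod]
  rcases lt_or_ge (x % q + y % q) q with h | h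
  · left; exact (Nat.mod_eq_of_lt h).symm
  · right; rw [Nat.mod_eq_sub_mod h, Nat.mod_eq_of_lt (a := _ - q) (by omega)]; omega

/-- If `(m, n)` is within taxicab distance `< q - 1` of a point `(u q, v q)` with `u, v` positive,
then some box has positive excess. -/
lemma exists_boxExcess_pos {q m n u v : ℕ} {a b : ℤ} (hodd : Odd q) (hu : 1 ≤ u) (hmn : m ≤ n)
    (ha : (m : ℤ) = u * q + a) (hb : (n : ℤ) = v * q + b) (hab : |a| + |b| < q - 1) :
    ∃ r, 1 ≤ r ∧ r ≤ m ∧ 0 < boxExcess q r (m - r) (n - r) := by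
  obtain ⟨k, hk⟩ := hodd
  have habs : a ≤ |a| ∧ -a ≤ |a| ∧ b ≤ |b| ∧ -b ≤ |b| :=
    ⟨le_abs_self a, neg_le_abs a, le_abs_self b, neg_le_abs b⟩
  have huv : u ≤ v := by
    by_contra! hlt
    have : ((v : ℤ) + 1) * q ≤ u * q := by gcongr; exact_mod_cast hlt
    have : (m : ℤ) ≤ n := by exact_mod_cast hmn
    have hlt : (a - b : ℤ) ≤ -q := by linarith
    omega
  obtain ⟨w, hw0, hw⟩ : ∃ w : ℤ, 0 ≤ w ∧ (u : ℤ) * q = w * q + q := ⟨u - 1, by omega, by ring⟩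
  obtain ⟨x, hx0, hx⟩ : ∃ x : ℤ, 0 ≤ x ∧ (v : ℤ) * q = u * q + x * q := ⟨v - u, by omega, by ring⟩
  obtain ⟨w, rfl⟩ := Int.eq_ofNat_of_zero_le hw0
  obtain ⟨x, rfl⟩ := Int.eq_ofNat_of_zero_le hx0
  -- The box has first side `r' + q * w`; `b'` and `c'` are the residues of the other two sides, and
  -- periodicity removes the multiples of `q`.
  have hmain : ∀ r' b' c' : ℕ, r' < q → b' < q → c' < q → 1 ≤ r' → (r' + b' : ℤ) = q + a →
      (r' + c' : ℤ) = q + b → q - 1 ≤ b' + c' → b' + c' ≤ q + 1 →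
      q < r' + b' + c' → r' + b' + c' < 2 * q →
      ∃ r, 1 ≤ r ∧ r ≤ m ∧ 0 < boxExcess q r (m - r) (n - r) := by
    intro r' b' c' hr hb' hc' h1 e1 e2 h2 h3 h4 h5
    have em : m = (r' + q * w) + b' := by zify; linarith
    have en : n = (r' + q * w) + (c' + q * x) := by zify; linarith
    refine ⟨r' + q * w, by omega, by omega, ?_⟩
    rw [em, Nat.add_sub_cancel_left, en, Nat.add_sub_cancel_left]
    rw [boxExcess_add_mul (by omega), boxExcess_comm', boxExcess_comm,
      boxExcess_add_mul (by omega), boxExcess_comm, boxExcess_comm', boxExcess_of_lt hr hb' hc']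
    have : |a| < q := by have := abs_nonneg b; omega
    have := abs_nonneg a
    omega
  have ha0 := abs_nonneg a
  have hb0 := abs_nonneg b
  rcases Int.even_or_odd' (a + b) with ⟨d, hd | hd⟩
  · have hab' : |a| + |b| + 2 < q := by
      rcases abs_cases a with h | h <;> rcases abs_cases b with h' | h' <;> omega
    -- With `q = 2 k + 1` this choice makes `b' + c'` equal to `q - 1` for even `a + b` and to `q`
    -- for odd `a + b`. The excess is then `(q - 1 - |a| - |b|) / 2`, respectively `(q - |a| - |b|)
    -- / 2`.
    refine hmain (k + d + 1).toNat (k + a - d).toNat (k + b - d).toNat ?_ ?_ ?_ ?_ ?_ ?_ ?_ ?_ ?_ ?_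
      <;> omega
  · refine hmain (k + d + 1).toNat (k + a - d).toNat (k + b - d).toNat ?_ ?_ ?_ ?_ ?_ ?_ ?_ ?_ ?_ ?_
      <;> omega

/-- The residues of `r` and `m - r` add up to `m % q` with or without a carry `q`, and likewise for
`n`; each carry pattern is linear arithmetic. -/
lemma boxExcess_eq_zero_of_half {q m n r : ℕ} (hodd : Odd q) (hr : r ≤ m) (hmn : m ≤ n)
    (hm : m % q = (q - 1) / 2 ∨ m % q = (q + 1) / 2)
    (hn : n % q = (q - 1) / 2 ∨ n % q = (q + 1) / 2) : boxExcess q r (m - r) (n - r) = 0 := by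
  obtain ⟨k, hk⟩ := hodd
  have hq : 0 < q := by omega
  have h1 := add_mod_cases hq r (m - r)
  have h2 := add_mod_cases hq r (n - r)
  rw [show r + (m - r) = m by omega] at h1
  rw [show r + (n - r) = n by omega] at h2
  have hr := Nat.mod_lt r hq
  have hb := Nat.mod_lt (m - r) hq
  have hc := Nat.mod_lt (n - r) hq
  rw [boxExcess_mod hq, boxExcess_of_lt hr hb hc]
  omega

/-- Without a carry in `r + (n - r)` the residues of the sides total `m + n % q - r ≤ q`. A carry
needs `n % q < r`, which by `h1` leaves only `r = m`, a box with an empty side. -/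
lemma boxExcess_eq_zero_of_small {q m n r : ℕ} (hr1 : 1 ≤ r) (hr : r ≤ m) (hmn : m ≤ n)
    (hmq : m < q) (h1 : m ≤ n % q + 1) (h2 : n % q + m ≤ q + 1) :
    boxExcess q r (m - r) (n - r) = 0 := by
  have hq : 0 < q := by omega
  have h := add_mod_cases hq r (n - r)
  rw [show r + (n - r) = n by omega, Nat.mod_eq_of_lt (show r < q by omega)] at h
  have hc := Nat.mod_lt (n - r) hq
  rw [boxExcess_mod hq, Nat.mod_eq_of_lt (show r < q by omega),
    Nat.mod_eq_of_lt (show m - r < q by omega), boxExcess_of_lt (by omega) (by omega) hc]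
  omega

/-! ### Binomial determinants and their prime divisors -/

section Determinants

open scoped Nat

/-- The binomial matrix whose determinant counts plane partitions in an `r × b × c` box. -/
def boxMatrix (r b c : ℕ) : Matrix (Fin r) (Fin r) ℤ :=
  Matrix.of fun i j => ((b + c + j).choose (b + i) : ℤ)

/-- After scaling rows by `(b + i)!` and columns by `(c + j)!`, what remains up to column factors is
a degree `i` polynomial evaluated at `c + j`, as in a Vandermonde matrix. -/
lemma choose_mul_factorials (b c i j : ℕ) :
    (b + c + j).choose (b + i) * (b + i)! * (c + j)! = (b + c + j)! * (c + j).descFactorial i := by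
  rcases le_or_gt i (c + j) with h | h
  · have h1 := Nat.choose_mul_factorial_mul_factorial (show b + i ≤ b + c + j by omega)
    have h2 := Nat.factorial_mul_descFactorial h
    rw [show b + c + j - (b + i) = c + j - i by omega] at h1
    rw [← h1, ← h2]
    ring
  · rw [Nat.choose_eq_zero_of_lt (by omega), Nat.descFactorial_of_lt h]
    simp

lemma det_descFactorial (r c : ℕ) :
    (Matrix.of fun i j : Fin r => ((c + j : ℕ).descFactorial i : ℤ)).det
      = ∏ j : Fin r, ((j : ℕ)! : ℤ) := by
  rw [← Matrix.det_transpose]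
  have h := Matrix.det_eval_matrixOfPolynomials_eq_det_vandermonde
    (fun j : Fin r => (j : ℤ) + c) (fun i : Fin r => descPochhammer ℤ i)
    (fun i => descPochhammer_natDegree ℤ i) (fun i => monic_descPochhammer ℤ i)
  have h2 : (Matrix.of fun i j : Fin r => ((c + j : ℕ).descFactorial i : ℤ)).transpose
      = Matrix.of fun i j : Fin r => (descPochhammer ℤ j).eval ((i : ℤ) + c) := by
    ext i j
    simp only [Matrix.transpose_apply, Matrix.of_apply]
    rw [← descPochhammer_eval_eq_descFactorial]
    push_cast
    rw [add_comm]
  rw [h2, ← h, Matrix.det_vandermonde_add]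
  cases r with
  | zero => simp
  | succ n =>
    rw [Matrix.det_vandermonde_id_eq_superFactorial, ← Nat.prod_range_succ_factorial,
      Finset.prod_range]
    push_cast
    rfl

lemma det_boxMatrix_mul (r b c : ℕ) :
    (boxMatrix r b c).det * ∏ j : Fin r, (((b + j)! * (c + j)! : ℕ) : ℤ)
      = ∏ j : Fin r, (((b + c + j)! * (j : ℕ)! : ℕ) : ℤ) := by
  have h1 := Matrix.det_mul_column (fun i : Fin r => ((b + i)! : ℤ)) (boxMatrix r b c)
  have h2 := Matrix.det_mul_row (fun j : Fin r => ((c + j)! : ℤ))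
    (Matrix.of fun i j : Fin r => ((b + i)! : ℤ) * boxMatrix r b c i j)
  have h3 := Matrix.det_mul_row (fun j : Fin r => ((b + c + j)! : ℤ))
    (Matrix.of fun i j : Fin r => ((c + j : ℕ).descFactorial i : ℤ))
  have h4 : (Matrix.of fun i j : Fin r => ((c + j)! : ℤ) *
      (Matrix.of fun i j : Fin r => ((b + i)! : ℤ) * boxMatrix r b c i j) i j) =
      Matrix.of fun i j : Fin r => ((b + c + j)! : ℤ) *
        (Matrix.of fun i j : Fin r => ((c + j : ℕ).descFactorial i : ℤ)) i j := by
    ext i j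
    simp only [Matrix.of_apply, boxMatrix]
    have := choose_mul_factorials b c i j
    zify at this
    linarith
  rw [h4, h3, h1, det_descFactorial] at h2
  push_cast
  rw [Finset.prod_mul_distrib, Finset.prod_mul_distrib, h2]
  ring

lemma padicValNat_prod_factorial {p : ℕ} [Fact p.Prime] (x r B : ℕ) (hB : x + r < p ^ B) :
    padicValNat p (∏ j : Fin r, (x + j)!)
      = ∑ e ∈ Finset.Ico 1 B, (sumDiv (p ^ e) (x + r) - sumDiv (p ^ e) x) := by
  induction r with
  | zero => simp
  | succ r ih =>
    rw [Fin.prod_univ_castSucc, padicValNat.mul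
      (Finset.prod_ne_zero_iff.2 fun _ _ => Nat.factorial_ne_zero _) (Nat.factorial_ne_zero _)]
    simp only [Fin.val_castSucc, Fin.val_last]
    rw [ih (by omega), padicValNat_factorial (b := B)
      (Nat.log_lt_of_lt_pow' (by rintro rfl; simp at hB) (by omega)), ← Finset.sum_add_distrib]
    refine Finset.sum_congr rfl fun e _ => ?_
    rw [← sum_range_add_div, ← sum_range_add_div, Finset.sum_range_succ]
    generalize (x + r) / p ^ e = y
    omega

/-- Legendre's formula turns the product formula into a sum of excesses, which are nonnegative and
so cannot cancel. Exponents from `B` on contribute nothing. -/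
lemma prime_dvd_det_boxMatrix_iff {p : ℕ} (hp : p.Prime) (r b c : ℕ) :
    (p : ℤ) ∣ (boxMatrix r b c).det ↔ ∃ e, 1 ≤ e ∧ 0 < boxExcess (p ^ e) r b c := by
  have := Fact.mk hp
  obtain ⟨B, hB⟩ : ∃ B, b + c + r < p ^ B := ⟨b + c + r, Nat.lt_pow_self hp.one_lt⟩
  have hdet := det_boxMatrix_mul r b c
  set D := (boxMatrix r b c).det
  have hD : 0 < D := by
    have h1 : (0 : ℤ) < ∏ j : Fin r, (((b + c + j)! * (j : ℕ)! : ℕ) : ℤ) :=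
      Finset.prod_pos fun _ _ => by positivity
    rw [← hdet] at h1
    exact pos_of_mul_pos_left h1 (Finset.prod_nonneg fun _ _ => by positivity)
  obtain ⟨N, hN⟩ := Int.eq_ofNat_of_zero_le hD.le
  rw [hN] at hdet hD ⊢
  have hN0 : N ≠ 0 := by rintro rfl; simp at hD
  have hdet' : N * ((∏ j : Fin r, (b + j)!) * ∏ j : Fin r, (c + j)!)
      = (∏ j : Fin r, (b + c + j)!) * ∏ j : Fin r, (0 + j)! := by
    rw [← Finset.prod_mul_distrib, ← Finset.prod_mul_distrib]
    simp only [zero_add]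
    exact_mod_cast hdet
  have hne : ∀ x, ∏ j : Fin r, (x + j)! ≠ 0 := fun x =>
    Finset.prod_ne_zero_iff.2 fun _ _ => Nat.factorial_ne_zero _
  have hv := congrArg (padicValNat p) hdet'
  rw [padicValNat.mul hN0 (mul_ne_zero (hne _) (hne _)), padicValNat.mul (hne _) (hne _),
    padicValNat.mul (hne _) (hne _), padicValNat_prod_factorial b r B (by omega),
    padicValNat_prod_factorial c r B (by omega), padicValNat_prod_factorial (b + c) r B (by omega),
    padicValNat_prod_factorial 0 r B (by omega)] at hv
  have hval : (padicValNat p N : ℤ) = ∑ e ∈ Finset.Ico 1 B, boxExcess (p ^ e) r b c := by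
    have hle : ∀ q x, sumDiv q x ≤ sumDiv q (x + r) := fun q x =>
      (sum_range_add_div q x r) ▸ Nat.le_add_left _ _
    have : ∀ e, boxExcess (p ^ e) r b c
        = ((sumDiv (p ^ e) (b + c + r) - sumDiv (p ^ e) (b + c) : ℕ) : ℤ)
          + (sumDiv (p ^ e) (0 + r) - sumDiv (p ^ e) 0 : ℕ)
          - ((sumDiv (p ^ e) (b + r) - sumDiv (p ^ e) b : ℕ) : ℤ)
          - ((sumDiv (p ^ e) (c + r) - sumDiv (p ^ e) c : ℕ) : ℤ) := fun e => by
      have h1 := hle (p ^ e) (b + c)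
      have h2 := hle (p ^ e) b
      have h3 := hle (p ^ e) c
      have h4 : sumDiv (p ^ e) 0 = 0 := sumDiv_of_le (Nat.zero_le _)
      unfold boxExcess
      rw [h4, zero_add]
      omega
    simp only [this, Finset.sum_sub_distrib, Finset.sum_add_distrib]
    zify at hv
    push_cast at hv ⊢
    linarith
  have hpos := fun e => boxExcess_nonneg (pow_pos hp.pos e) r b c
  rw [Int.natCast_dvd_natCast, dvd_iff_padicValNat_ne_zero hN0, ← Nat.cast_ne_zero (R := ℤ), hval,
    Ne, Finset.sum_eq_zero_iff_of_nonneg fun e _ => hpos e]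
  push Not
  constructor
  · rintro ⟨e, he, hne⟩
    exact ⟨e, (Finset.mem_Ico.1 he).1, lt_of_le_of_ne (hpos e) hne.symm⟩
  · rintro ⟨e, he, hlt⟩
    refine ⟨e, Finset.mem_Ico.2 ⟨he, ?_⟩, hlt.ne'⟩
    by_contra! hBe
    have := Nat.pow_le_pow_right hp.pos hBe
    rw [boxExcess_eq_zero_of_lt (by omega)] at hlt
    exact hlt.false

/-! ### Which pairs have no positive excess -/

lemma exists_nearest_multiple (q x : ℕ) (hq : Odd q) (hx : q ≤ x) :
    ∃ (u : ℕ) (a : ℤ), 1 ≤ u ∧ (x : ℤ) = u * q + a ∧ 2 * |a| + 1 ≤ q ∧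
      (2 * |a| + 1 = q → x % q = (q - 1) / 2 ∨ x % q = (q + 1) / 2) := by
  obtain ⟨k, hk⟩ := hq
  have hlt := Nat.mod_lt x (show 0 < q by omega)
  have hdiv : 1 ≤ x / q := (Nat.one_le_div_iff (by omega)).2 hx
  have hdm := Nat.mod_add_div x q
  zify at hdm
  rcases le_or_gt (x % q) k with h | h
  · refine ⟨x / q, (x % q : ℕ), hdiv, by push_cast; linarith, ?_, ?_⟩
    · rw [abs_of_nonneg (by positivity)]; omega
    · rw [abs_of_nonneg (by positivity)]; omega
  · refine ⟨x / q + 1, (x % q : ℕ) - q, by omega, by push_cast; linarith, ?_, ?_⟩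
    · rw [abs_of_nonpos (by omega)]; omega
    · rw [abs_of_nonpos (by omega)]; omega

/-- `p ^ t` is an odd multiple of `p ^ e`, so halving it leaves half of `p ^ e` modulo `p ^ e`. -/
lemma half_mod {p t : ℕ} (hp : Odd p) {e x : ℕ} (he : e ≤ t)
    (hx : x % p ^ t = (p ^ t - 1) / 2 ∨ x % p ^ t = (p ^ t + 1) / 2) :
    x % p ^ e = (p ^ e - 1) / 2 ∨ x % p ^ e = (p ^ e + 1) / 2 := by
  obtain ⟨k, hk⟩ := hp.pow (n := e)
  obtain ⟨l, hl⟩ := hp.pow (n := t - e)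
  have hpt : p ^ t = p ^ e * p ^ (t - e) := by rw [← pow_add]; congr 1; omega
  have hmod : x % p ^ e = (x % p ^ t) % p ^ e := by
    rw [Nat.mod_mod_of_dvd _ (pow_dvd_pow p he)]
  rw [hmod]
  have hval : p ^ t = 2 * (k + p ^ e * l) + 1 := by rw [hpt, hl, hk]; ring
  rcases hx with hx | hx
  · left
    rw [hx, show (p ^ t - 1) / 2 = k + p ^ e * l by omega, Nat.add_mul_mod_self_left,
      Nat.mod_eq_of_lt (by omega)]
    omega
  · rw [hx, show (p ^ t + 1) / 2 = (k + 1) + p ^ e * l by omega, Nat.add_mul_mod_self_left]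
    rcases Nat.eq_zero_or_pos k with rfl | hk0
    · left; rw [hk]; simp
    · right; rw [Nat.mod_eq_of_lt (by omega)]; omega

lemma forall_boxExcess_eq_zero_iff {p m n t : ℕ} (hp : Odd p) (hp3 : 3 ≤ p) (ht : 1 ≤ t)
    (hmt : p ^ t ≤ m) (hmt' : m < p ^ (t + 1)) (hmn : m ≤ n) :
    (∀ r e, 1 ≤ r → r ≤ m → 1 ≤ e → ¬ 0 < boxExcess (p ^ e) r (m - r) (n - r)) ↔
      (m, n) ∈ standardPairs p t := by
  have hodd : ∀ e, Odd (p ^ e) := fun e => hp.pow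
  obtain ⟨k, hk⟩ := hodd t
  have hp0 : 0 < p := hp.pos
  have h3 : 3 ≤ p ^ t := hp3.trans (Nat.le_self_pow (by omega) p)
  constructor
  · intro H
    obtain ⟨u, a, hu, hma, ha, ha'⟩ := exists_nearest_multiple (p ^ t) m (hodd t) hmt
    obtain ⟨v, b, hv, hnb, hb, hb'⟩ := exists_nearest_multiple (p ^ t) n (hodd t) (hmt.trans hmn)
    -- Both `|a|` and `|b|` are at most `(p ^ t - 1) / 2`, so failure of the taxicab bound forces
    -- equality in both.
    have hab : ¬ |a| + |b| < ((p ^ t : ℕ) : ℤ) - 1 := fun hab => by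
      obtain ⟨r, h1, h2, h3⟩ := exists_boxExcess_pos (hodd t) hu hmn hma hnb hab
      exact H r t h1 h2 ht h3
    have hm := ha' (by omega)
    have hn := hb' (by omega)
    set Q := p ^ (t + 1) with hQ
    have hQq : Q = p ^ t * p := pow_succ p t
    have hQ0 : 0 < Q := by positivity
    have hnQ : n % Q = n % p ^ t + p ^ t * (n / p ^ t % p) := by rw [hQq, Nat.mod_mul]
    have hdQ := Nat.mod_add_div n Q
    zify at hdQ
    have hlt := Nat.mod_lt n hQ0
    -- Since `m < Q`, the lattice points to avoid are `(Q, v Q)` and `(Q, (v + 1) Q)` with `v = n /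
    -- Q`; they give `hlo` and `hhi`.
    have hlo : m ≤ n % Q + 1 := by
      by_contra! hcon
      obtain ⟨r, h1, h2, h3⟩ := exists_boxExcess_pos (q := Q) (u := 1) (v := n / Q) (a := m - Q)
        (b := (n % Q : ℕ)) (hodd _) le_rfl hmn (by push_cast; ring) (by push_cast; linarith)
        (by rw [abs_of_nonpos (by omega), abs_of_nonneg (by positivity)]; omega)
      exact H r (t + 1) h1 h2 (by omega) h3
    have hhi : n % Q + m ≤ Q + 1 := by
      by_contra! hcon
      obtain ⟨r, h1, h2, h3⟩ := exists_boxExcess_pos (q := Q) (u := 1) (v := n / Q + 1)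
        (a := m - Q) (b := (n % Q : ℕ) - Q) (hodd _) le_rfl hmn (by push_cast; ring)
        (by push_cast; linarith)
        (by rw [abs_of_nonpos (by omega), abs_of_nonpos (by omega)]; omega)
      exact H r (t + 1) h1 h2 (by omega) h3
    have hmd := Nat.mod_add_div m (p ^ t)
    have hi1 : 1 ≤ m / p ^ t := (Nat.one_le_div_iff (by positivity)).2 hmt
    set i := m / p ^ t
    set j := n / p ^ t % p
    rw [hnQ] at hlo hhi
    -- The residues modulo `p ^ t` differ by at most one and `p ^ t ≥ 3`, so the slack of one in
    -- `hlo` cannot allow `j < i`.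
    have hij : i ≤ j := by
      by_contra! hcon
      have := Nat.mul_le_mul_left (p ^ t) (Nat.succ_le_of_lt hcon)
      rw [Nat.succ_eq_add_one, mul_add] at this
      omega
    have hjp : i + j < p := by
      by_contra! hcon
      have := Nat.mul_le_mul_left (p ^ t) hcon
      rw [mul_add] at this
      omega
    refine ⟨i, j, n / Q, m % p ^ t, n % p ^ t, hi1, by omega, hij, by omega, hm, hn, ?_⟩
    rw [Prod.mk.injEq]
    constructor
    · linarith
    · have := Nat.mod_add_div n Q
      rw [hnQ] at this
      rw [← hQ, mul_comm j, mul_comm (n / Q)]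
      linarith
  · rintro ⟨i, j, k', c, d, hi, hi', hij, hj, hc, hd, heq⟩ r e hr1 hr he
    obtain ⟨rfl, rfl⟩ := Prod.mk.inj heq
    by_contra hpos
    have hj' : i + j + 1 ≤ p := by omega
    have hmm : (i * p ^ t + c) % p ^ t = c := by
      rw [add_comm, Nat.add_mul_mod_self_right, Nat.mod_eq_of_lt (by omega)]
    have hnm : (j * p ^ t + d + k' * p ^ (t + 1)) % p ^ (t + 1) = j * p ^ t + d := by
      rw [Nat.add_mul_mod_self_right, Nat.mod_eq_of_lt]
      have := Nat.mul_le_mul_left (p ^ t) (show j + 2 ≤ p by omega)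
      rw [pow_succ]
      linarith [show d < 2 * p ^ t by omega]
    have hnm' : (j * p ^ t + d + k' * p ^ (t + 1)) % p ^ t = d := by
      rw [← Nat.mod_mod_of_dvd _ (pow_dvd_pow p (Nat.le_succ t)), hnm, add_comm,
        Nat.add_mul_mod_self_right, Nat.mod_eq_of_lt (by omega)]
    rcases le_or_gt e t with het | het
    · rw [boxExcess_eq_zero_of_half (hodd e) hr hmn (half_mod hp het (by rwa [hmm]))
        (half_mod hp het (by rwa [hnm']))] at hpos
      exact hpos.false
    -- Passing from `p ^ (t + 1)` to `p ^ e` adds `p ^ (t + 1) * x` to the residue of `n`, with `x <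
    -- p ^ (e - (t + 1))`, so both inequalities persist.
    · have hpe : p ^ e = p ^ (t + 1) * p ^ (e - (t + 1)) := by rw [← pow_add]; congr 1; omega
      set x := (j * p ^ t + d + k' * p ^ (t + 1)) / p ^ (t + 1) % p ^ (e - (t + 1))
      have hx : x + 1 ≤ p ^ (e - (t + 1)) := Nat.mod_lt _ (by positivity)
      have hx := Nat.mul_le_mul_left (p ^ (t + 1)) hx
      rw [← hpe, mul_add, mul_one] at hx
      have hmod : (j * p ^ t + d + k' * p ^ (t + 1)) % p ^ e = j * p ^ t + d + p ^ (t + 1) * x := by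
        rw [hpe, Nat.mod_mul, hnm]
      have h1 := Nat.mul_le_mul_left (p ^ t) hij
      have h2 := Nat.mul_le_mul_left (p ^ t) hj'
      rw [mul_add, mul_add, mul_one, ← pow_succ] at h2
      have hmul := mul_comm (p ^ t) i
      have hmul' := mul_comm (p ^ t) j
      rw [boxExcess_eq_zero_of_small hr1 hr hmn (by omega) (by rw [hmod]; omega)
        (by rw [hmod]; omega)] at hpos
      exact hpos.false

end Determinants

/-! ### Jordan chains of nilpotent endomorphisms -/

section Chains

variable {K M : Type*} [Field K] [AddCommGroup M] [Module K M]

lemma pow_apply_eq_zero_of_le {T : Module.End K M} {x : M} {d e : ℕ} (h : (T ^ d) x = 0)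
    (hde : d ≤ e) : (T ^ e) x = 0 := by
  obtain ⟨k, rfl⟩ := Nat.exists_eq_add_of_le' hde
  rw [pow_add, Module.End.mul_apply, h, map_zero]

/-- In a nontrivial relation take a nonzero coefficient with `d i - k` maximal and apply `T ^ (d i -
k - 1)`: only terms of the same height survive, and they land on the independent last vectors. -/
lemma linearIndependent_chains {ι : Type*} [Fintype ι] {T : Module.End K M} {w : ι → M}
    {d : ι → ℕ} (hT : ∀ i, (T ^ d i) (w i) = 0)
    (hli : LinearIndependent K fun i => (T ^ (d i - 1)) (w i)) :
    LinearIndependent K fun x : (i : ι) × Fin (d i) => (T ^ (x.2 : ℕ)) (w x.1) := by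
  classical
  rw [Fintype.linearIndependent_iff]
  intro g hg
  by_contra! hne
  obtain ⟨y, hy⟩ := hne
  obtain ⟨x₀, hx₀, hmax⟩ := Finset.exists_max_image
    (Finset.univ.filter fun x : (i : ι) × Fin (d i) => g x ≠ 0) (fun x => d x.1 - x.2)
    ⟨y, by simpa using hy⟩
  replace hx₀ : g x₀ ≠ 0 := by simpa using hx₀
  have hlt := x₀.2.2
  set D := d x₀.1 - x₀.2 - 1 with hD
  have hterm : ∀ x : (i : ι) × Fin (d i), (T ^ D) (g x • (T ^ (x.2 : ℕ)) (w x.1))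
      = (if (x.2 : ℕ) + D + 1 = d x.1 then g x else 0) • (T ^ (d x.1 - 1)) (w x.1) := by
    intro x
    rw [map_smul, ← Module.End.mul_apply, ← pow_add]
    split_ifs with h
    · rw [show d x.1 - 1 = D + x.2 by omega]
    · rcases eq_or_ne (g x) 0 with h0 | h0
      · simp [h0]
      · have := hmax x (by simpa using h0)
        have := x.2.2
        rw [pow_apply_eq_zero_of_le (hT x.1) (by omega), smul_zero, zero_smul]
  have hsum := congrArg (T ^ D) hg
  simp only [map_sum, hterm, map_zero, Fintype.sum_sigma, ← Finset.sum_smul] at hsum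
  have h0 := (Fintype.linearIndependent_iff.1 hli) _ hsum x₀.1
  rw [Finset.sum_eq_single x₀.2] at h0
  · rw [if_pos (by omega)] at h0
    exact hx₀ h0
  · intro k _ hk
    rw [if_neg]
    intro h
    exact hk (Fin.ext (by omega))
  · simp

lemma linearIndependent_chain {T : Module.End K M} {v : M} {d : ℕ} (hT : (T ^ d) v = 0)
    (hv : (T ^ (d - 1)) v ≠ 0) : LinearIndependent K fun k : Fin d => (T ^ (k : ℕ)) v := by
  have h := linearIndependent_chains (ι := Unit) (T := T) (w := fun _ => v) (d := fun _ => d)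
    (fun _ => hT) (LinearIndependent.of_subsingleton () hv)
  exact h.comp (fun k : Fin d => ⟨(), k⟩) fun a b hab => by simpa using hab

/-- The chains `w i, T (w i), …, T ^ (d i - 1) (w i)` form a Jordan basis of the nilpotent
endomorphism `T`. -/
structure IsJordanBasis {ι : Type*} (T : Module.End K M) (d : ι → ℕ) (w : ι → M) : Prop where
  pow_apply : ∀ i, (T ^ d i) (w i) = 0
  linearIndependent :
    LinearIndependent K fun x : (i : ι) × Fin (d i) => (T ^ (x.2 : ℕ)) (w x.1)
  span_eq_top :
    Submodule.span K (Set.range fun x : (i : ι) × Fin (d i) => (T ^ (x.2 : ℕ)) (w x.1)) = ⊤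

lemma IsJordanBasis.finrank_range_pow {ι : Type*} [Fintype ι] {T : Module.End K M} {d : ι → ℕ}
    {w : ι → M} (h : IsJordanBasis T d w) (k : ℕ) :
    Module.finrank K (LinearMap.range (T ^ k)) = ∑ i, (d i - k) := by
  let f : ((i : ι) × Fin (d i - k)) → (i : ι) × Fin (d i) :=
    fun x => ⟨x.1, ⟨x.2 + k, by have := x.2.2; omega⟩⟩
  have hf : Function.Injective f := by
    rintro ⟨i, a⟩ ⟨j, b⟩ hab
    simp only [f, Sigma.mk.injEq] at hab
    obtain ⟨rfl, hab⟩ := hab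
    have := Fin.val_eq_of_eq (eq_of_heq hab)
    simp only [Nat.add_right_cancel_iff] at this
    rw [Fin.ext this]
  have hli := h.linearIndependent.comp f hf
  have hrange : LinearMap.range (T ^ k) = Submodule.span K (Set.range
      ((fun x : (i : ι) × Fin (d i) => (T ^ (x.2 : ℕ)) (w x.1)) ∘ f)) := by
    rw [LinearMap.range_eq_map, ← h.span_eq_top, Submodule.map_span]
    apply le_antisymm
    · rw [Submodule.span_le]
      rintro _ ⟨_, ⟨⟨i, j⟩, rfl⟩, rfl⟩
      simp only [SetLike.mem_coe]
      rw [← Module.End.mul_apply, ← pow_add]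
      rcases lt_or_ge (k + j) (d i) with hlt | hge
      · apply Submodule.subset_span
        refine ⟨⟨i, ⟨j, by omega⟩⟩, ?_⟩
        simp [f, add_comm]
      · rw [pow_apply_eq_zero_of_le (h.pow_apply i) hge]
        exact zero_mem _
    · rw [Submodule.span_le]
      rintro _ ⟨⟨i, j⟩, rfl⟩
      apply Submodule.subset_span
      refine ⟨_, ⟨⟨i, ⟨j, by omega⟩⟩, rfl⟩, ?_⟩
      simp only [f, Function.comp]
      rw [← Module.End.mul_apply, ← pow_add, add_comm]
  rw [hrange, finrank_span_eq_card hli]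
  simp

lemma finrank_le_of_pow_apply_ne_zero [FiniteDimensional K M] {T : Module.End K M} {v : M} {d : ℕ}
    (hT : (T ^ d) v = 0) (hv : (T ^ (d - 1)) v ≠ 0) (A : Submodule K M)
    (hA : ∀ k, (T ^ k) v ∈ A) : d ≤ Module.finrank K A := by
  have hli := linearIndependent_chain hT hv
  have : LinearIndependent K fun k : Fin d => (⟨(T ^ (k : ℕ)) v, hA k⟩ : A) :=
    LinearIndependent.of_comp A.subtype hli
  simpa using this.fintype_card_le_finrank

/-- A nilpotent endomorphism without nontrivial invariant decompositions is a single Jordan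
block. -/
lemma exists_cyclic_vector [FiniteDimensional K M] [Nontrivial M] {T : Module.End K M}
    (hT : IsNilpotent T)
    (hind : ∀ A B : Submodule K M, (∀ x ∈ A, T x ∈ A) → (∀ x ∈ B, T x ∈ B) → IsCompl A B →
      A = ⊥ ∨ B = ⊥) :
    T ^ Module.finrank K M = 0 ∧ ∃ v, (T ^ (Module.finrank K M - 1)) v ≠ 0 := by
  obtain ⟨r, hr, hr'⟩ : ∃ r, T ^ r = 0 ∧ T ^ (r - 1) ≠ 0 := by
    refine ⟨nilpotencyClass T, pow_nilpotencyClass hT, ?_⟩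
    exact pow_pred_nilpotencyClass hT
  obtain ⟨v, hv⟩ : ∃ v, (T ^ (r - 1)) v ≠ 0 := by
    by_contra! h
    exact hr' (LinearMap.ext h)
  have hrv : (T ^ r) v = 0 := by rw [hr]; rfl
  suffices h : Module.finrank K M = r by rw [h]; exact ⟨hr, v, hv⟩
  have hr1 : 1 ≤ r := by
    rcases Nat.eq_zero_or_pos r with rfl | h
    · exact absurd hrv (by simpa using hv)
    · exact h
  obtain ⟨φ, hφ⟩ := Module.Projective.exists_dual_ne_zero K hv
  -- `ker Φ` will be an invariant complement of the chain of `v`: the matrix `φ (T ^ (j + i) v)`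
  -- vanishes for `j + i ≥ r` and is nonzero on `j + i = r - 1`, hence is invertible.
  let Φ : M →ₗ[K] (Fin r → K) := LinearMap.pi fun k => φ ∘ₗ (T ^ (k : ℕ))
  have hΦ : LinearIndependent K (Φ ∘ fun k : Fin r => (T ^ (k : ℕ)) v) := by
    rw [Fintype.linearIndependent_iff]
    intro g hg
    have hg' : ∀ j : Fin r, ∑ i : Fin r, g i * φ ((T ^ (j + i : ℕ)) v) = 0 := fun j => by
      have := congrFun hg j
      simpa [Φ, pow_add] using this
    suffices H : ∀ (k : ℕ) (hk : k < r), g ⟨k, hk⟩ = 0 from fun k => H k k.2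
    intro k
    induction k using Nat.strong_induction_on with
    | _ k ih =>
      intro hk
      have h := hg' ⟨r - 1 - k, by omega⟩
      rw [Finset.sum_eq_single ⟨k, hk⟩] at h
      · simp only [show r - 1 - k + k = r - 1 by omega] at h
        exact (mul_eq_zero.1 h).resolve_right hφ
      · intro i _ hi
        have hi' : (i : ℕ) ≠ k := fun h => hi (Fin.ext h)
        rcases lt_or_gt_of_ne hi' with hlt | hgt
        · have := ih i hlt i.2
          rw [Fin.eta] at this
          rw [this, zero_mul]
        · simp only
          rw [pow_apply_eq_zero_of_le hrv (by omega), map_zero, mul_zero]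
      · simp
  set C := Submodule.span K (Set.range fun k : Fin r => (T ^ (k : ℕ)) v) with hC
  have hdisj : Disjoint C (LinearMap.ker Φ) := Submodule.range_ker_disjoint hΦ
  have hcodisj : Codisjoint C (LinearMap.ker Φ) := by
    rw [codisjoint_iff, ← Submodule.comap_map_eq, hC, Submodule.map_span, ← Set.range_comp,
      hΦ.span_eq_top_of_card_eq_finrank' (by simp), Submodule.comap_top]
  have hCT : ∀ x ∈ C, T x ∈ C := by
    intro x hx
    have : C ≤ C.comap T := by
      rw [hC, Submodule.span_le]
      rintro _ ⟨k, rfl⟩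
      simp only [Submodule.comap_coe, Set.mem_preimage, SetLike.mem_coe]
      rw [← Module.End.mul_apply, ← pow_succ']
      rcases lt_or_ge ((k : ℕ) + 1) r with h | h
      · exact Submodule.subset_span ⟨⟨k + 1, h⟩, rfl⟩
      · rw [pow_apply_eq_zero_of_le hrv h]
        exact zero_mem _
    exact this hx
  have hBT : ∀ x ∈ LinearMap.ker Φ, T x ∈ LinearMap.ker Φ := by
    intro x hx
    have hx' : ∀ k, φ ((T ^ k) x) = 0 := fun k => by
      rcases lt_or_ge k r with h | h
      · exact congrFun (LinearMap.mem_ker.1 hx) ⟨k, h⟩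
      · rw [pow_apply_eq_zero_of_le (by rw [hr]; rfl) h, map_zero]
    rw [LinearMap.mem_ker]
    ext k
    have := hx' (k + 1)
    rwa [pow_succ, Module.End.mul_apply] at this
  have hcard : Module.finrank K C = r := by
    rw [hC, finrank_span_eq_card (linearIndependent_chain hrv hv), Fintype.card_fin]
  rcases hind C _ hCT hBT ⟨hdisj, hcodisj⟩ with h | h
  · rw [h, finrank_bot] at hcard
    omega
  · rw [h, codisjoint_bot] at hcodisj
    rw [← hcard, hcodisj, finrank_top]

/-- One component of `v` is not killed by the top nonzero power of `T`; its chain has full length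
and fills the space. -/
lemma eq_bot_or_eq_bot_of_cyclic [FiniteDimensional K M] {T : Module.End K M} {v : M}
    (hT : T ^ Module.finrank K M = 0) (hv : (T ^ (Module.finrank K M - 1)) v ≠ 0)
    {A B : Submodule K M} (hA : ∀ x ∈ A, T x ∈ A) (hB : ∀ x ∈ B, T x ∈ B) (hAB : IsCompl A B) :
    A = ⊥ ∨ B = ⊥ := by
  have hpow : ∀ {C : Submodule K M}, (∀ x ∈ C, T x ∈ C) → ∀ x ∈ C, ∀ k, (T ^ k) x ∈ C := by
    intro C hC x hx k
    induction k with
    | zero => simpa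
    | succ k ih => rw [pow_succ', Module.End.mul_apply]; exact hC _ ih
  have key : ∀ {C : Submodule K M}, (∀ x ∈ C, T x ∈ C) → ∀ x ∈ C,
      (T ^ (Module.finrank K M - 1)) x ≠ 0 → C = ⊤ := fun hC x hx hne =>
    Submodule.eq_top_of_finrank_eq (le_antisymm (Submodule.finrank_le _)
      (finrank_le_of_pow_apply_ne_zero (by rw [hT]; rfl) hne _ (hpow hC x hx)))
  obtain ⟨a, ha, b, hb, rfl⟩ := Submodule.mem_sup.1
    (hAB.sup_eq_top ▸ Submodule.mem_top : v ∈ A ⊔ B)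
  by_cases h : (T ^ (Module.finrank K M - 1)) a = 0
  · rw [map_add, h, zero_add] at hv
    left
    rw [key hB b hb hv] at hAB
    simpa using hAB.inf_eq_bot
  · right
    rw [key hA a ha h] at hAB
    simpa using hAB.inf_eq_bot

end Chains

/-! ### Indecomposable summands as Jordan blocks of `g - 1` -/

section Representations

variable {K G M : Type*} [Field K] [Group G] [AddCommGroup M] [Module K M]
  {τ : Representation K G M} {g : G}

lemma apply_mem_of_generator [Finite G] (hg : ∀ x, x ∈ Subgroup.zpowers g) {A : Submodule K M}
    (hA : ∀ x ∈ A, (τ g - 1) x ∈ A) (h : G) ⦃x : M⦄ (hx : x ∈ A) : τ h x ∈ A := by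
  have hgA : ∀ x ∈ A, τ g x ∈ A := fun x hx => by
    have := add_mem (hA x hx) hx
    simpa using this
  obtain ⟨k, rfl⟩ := Submonoid.mem_powers_iff _ _ |>.1 (mem_powers_iff_mem_zpowers.2 (hg h))
  rw [map_pow]
  induction k with
  | zero => simpa
  | succ k ih => rw [pow_succ', Module.End.mul_apply]; exact hgA _ ih

/-- In characteristic `p`, `(τ g - 1) ^ (p ^ a) = τ (g ^ (p ^ a)) - 1 = 0`. -/
lemma isNilpotent_sub_one {p a : ℕ} [Fact p.Prime] [CharP K p] (hG : Nat.card G = p ^ a) :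
    IsNilpotent (τ g - 1) := by
  refine ⟨p ^ a, ?_⟩
  rcases subsingleton_or_nontrivial M with h | h
  · exact Subsingleton.elim _ _
  have : CharP (Module.End K M) p :=
    charP_of_injective_algebraMap (algebraMap K (Module.End K M)).injective p
  rw [sub_pow_char_pow_of_commute _ _ (Commute.one_right _), ← map_pow, ← hG, pow_card_eq_one']
  simp

lemma IsIndecomposable.exists_cyclic_vector {p a : ℕ} [Fact p.Prime] [CharP K p]
    [FiniteDimensional K M] (hG : Nat.card G = p ^ a) (hg : ∀ x, x ∈ Subgroup.zpowers g)
    (hτ : IsIndecomposable τ) :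
    (τ g - 1) ^ Module.finrank K M = 0 ∧ ∃ v, ((τ g - 1) ^ (Module.finrank K M - 1)) v ≠ 0 := by
  have : Finite G := Nat.finite_of_card_ne_zero
    (by rw [hG]; exact pow_ne_zero _ (Fact.out : p.Prime).ne_zero)
  have := hτ.1
  refine JordanPartition.exists_cyclic_vector (isNilpotent_sub_one hG) fun A B hA hB hAB => ?_
  have h := hτ.2 ⟨A, apply_mem_of_generator hg hA⟩ ⟨B, apply_mem_of_generator hg hB⟩
    ⟨disjoint_iff.2 (Subrepresentation.toSubmodule_injective hAB.inf_eq_bot),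
      codisjoint_iff.2 (Subrepresentation.toSubmodule_injective hAB.sup_eq_top)⟩
  exact h.imp (congrArg Subrepresentation.toSubmodule) (congrArg Subrepresentation.toSubmodule)

lemma isIndecomposable_of_cyclic [FiniteDimensional K M] [Nontrivial M]
    (hT : (τ g - 1) ^ Module.finrank K M = 0) {v : M}
    (hv : ((τ g - 1) ^ (Module.finrank K M - 1)) v ≠ 0) : IsIndecomposable τ := by
  refine ⟨inferInstance, fun A B hAB => ?_⟩
  have hinv : ∀ (C : Subrepresentation τ), ∀ x ∈ C.toSubmodule, (τ g - 1) x ∈ C.toSubmodule :=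
    fun C x hx => sub_mem (C.apply_mem_toSubmodule g hx) hx
  have h := eq_bot_or_eq_bot_of_cyclic hT hv (hinv A) (hinv B)
    ⟨disjoint_iff.2 (congrArg Subrepresentation.toSubmodule hAB.inf_eq_bot),
      codisjoint_iff.2 (congrArg Subrepresentation.toSubmodule hAB.sup_eq_top)⟩
  exact h.imp (fun h => Subrepresentation.toSubmodule_injective h)
    (fun h => Subrepresentation.toSubmodule_injective h)

lemma coe_toRepresentation_sub_one_pow (U : Subrepresentation τ) (k : ℕ) (x : U.toSubmodule) :
    (((U.toRepresentation g - 1) ^ k) x : M) = ((τ g - 1) ^ k) x := by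
  induction k with
  | zero => simp
  | succ k ih =>
    rw [pow_succ', pow_succ', Module.End.mul_apply, Module.End.mul_apply, ← ih]
    rfl

lemma HasDecomposition.exists_isJordanBasis {p a : ℕ} [Fact p.Prime] [CharP K p]
    [FiniteDimensional K M] (hG : Nat.card G = p ^ a) (hg : ∀ x, x ∈ Subgroup.zpowers g)
    {l : List ℕ} (h : HasDecomposition τ l) :
    (∀ i, 1 ≤ l.get i) ∧ ∃ w : Fin l.length → M, IsJordanBasis (τ g - 1) l.get w := by
  obtain ⟨U, hU, hUi⟩ := h
  have hpos : ∀ i, 1 ≤ l.get i := fun i => by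
    rw [← (hUi i).2]
    have := (hUi i).1.1
    exact Module.finrank_pos
  refine ⟨hpos, ?_⟩
  choose hT v hv using fun i => (hUi i).1.exists_cyclic_vector hG hg
  let b : ∀ i, Module.Basis (Fin (l.get i)) K (U i).toSubmodule := fun i =>
    have : Nonempty (Fin (l.get i)) := ⟨⟨0, hpos i⟩⟩
    basisOfLinearIndependentOfCardEqFinrank
      (linearIndependent_chain (T := (U i).toRepresentation g - 1) (v := v i) (d := l.get i)
        (by rw [← (hUi i).2, hT i]; rfl) (by rw [← (hUi i).2]; exact hv i))
      (by rw [Fintype.card_fin, (hUi i).2])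
  have hb : ⇑(hU.collectedBasis b) = fun x : (i : Fin l.length) × Fin (l.get i) =>
      ((τ g - 1) ^ (x.2 : ℕ)) (v x.1 : M) := by
    rw [DirectSum.IsInternal.collectedBasis_coe]
    ext x
    simp [b, coe_toRepresentation_sub_one_pow]
  refine ⟨fun i => v i, ⟨fun i => ?_, hb ▸ (hU.collectedBasis b).linearIndependent,
    hb ▸ (hU.collectedBasis b).span_eq⟩⟩
  rw [← coe_toRepresentation_sub_one_pow, ← (hUi i).2, hT i]
  rfl

lemma IsJordanBasis.hasDecomposition [FiniteDimensional K M] [Finite G]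
    (hg : ∀ x, x ∈ Subgroup.zpowers g) {l : List ℕ} (hpos : ∀ i, 1 ≤ l.get i)
    {w : Fin l.length → M} (h : IsJordanBasis (τ g - 1) l.get w) : HasDecomposition τ l := by
  set T := τ g - 1 with hTdef
  set f := fun x : (i : Fin l.length) × Fin (l.get i) => (T ^ (x.2 : ℕ)) (w x.1) with hf
  let S : Fin l.length → Submodule K M := fun i =>
    Submodule.span K (Set.range fun k : Fin (l.get i) => f ⟨i, k⟩)
  have hli : ∀ i, LinearIndependent K fun k : Fin (l.get i) => f ⟨i, k⟩ := fun i =>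
    h.linearIndependent.comp _ sigma_mk_injective
  have hS : ∀ i, ∀ x ∈ S i, T x ∈ S i := by
    intro i x hx
    have : S i ≤ (S i).comap T := by
      refine Submodule.span_le.2 ?_
      rintro _ ⟨k, rfl⟩
      simp only [Submodule.comap_coe, Set.mem_preimage, SetLike.mem_coe, hf]
      rw [← Module.End.mul_apply, ← pow_succ']
      rcases lt_or_ge ((k : ℕ) + 1) (l.get i) with hk | hk
      · exact Submodule.subset_span ⟨⟨k + 1, hk⟩, rfl⟩
      · rw [pow_apply_eq_zero_of_le (h.pow_apply i) hk]
        exact zero_mem _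
    exact this hx
  let U : Fin l.length → Subrepresentation τ := fun i => ⟨S i, apply_mem_of_generator hg (hS i)⟩
  have himage : ∀ i, S i = Submodule.span K (f '' {x | x.1 = i}) := fun i => by
    refine congrArg (Submodule.span K) (Set.ext fun y => ?_)
    constructor
    · rintro ⟨k, rfl⟩
      exact ⟨⟨i, k⟩, rfl, rfl⟩
    · rintro ⟨⟨j, k⟩, rfl, rfl⟩
      exact ⟨k, rfl⟩
  refine ⟨U, ?_, fun i => ?_⟩
  · rw [DirectSum.isInternal_submodule_iff_iSupIndep_and_iSup_eq_top]
    constructor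
    · intro i
      have hle : ⨆ j, ⨆ (_ : j ≠ i), (U j).toSubmodule ≤ Submodule.span K (f '' {x | x.1 ≠ i}) := by
        refine iSup₂_le fun j hj => ?_
        change S j ≤ _
        rw [himage]
        refine Submodule.span_mono (Set.image_mono ?_)
        rintro x rfl
        exact hj
      refine Disjoint.mono_right hle ?_
      change Disjoint (S i) _
      rw [himage]
      refine h.linearIndependent.disjoint_span_image ?_
      rw [Set.disjoint_left]
      exact fun x h1 h2 => h2 h1
    · rw [eq_top_iff, ← h.span_eq_top, Submodule.span_le]
      rintro _ ⟨⟨i, k⟩, rfl⟩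
      exact Submodule.mem_iSup_of_mem (p := fun i => (U i).toSubmodule) i
        (Submodule.subset_span ⟨k, rfl⟩)
  · have hfin : Module.finrank K (U i).toSubmodule = l.get i := by
      change Module.finrank K (S i) = _
      rw [finrank_span_eq_card (hli i), Fintype.card_fin]
    refine ⟨?_, hfin⟩
    have : Nontrivial (U i).toSubmodule :=
      Module.nontrivial_of_finrank_pos (R := K) (by rw [hfin]; exact hpos i)
    have hmem : w i ∈ (U i).toSubmodule :=
      Submodule.subset_span ⟨⟨0, hpos i⟩, by simp [hf]⟩
    have hkill : ∀ x ∈ S i, (T ^ l.get i) x = 0 := by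
      intro x hx
      have : S i ≤ LinearMap.ker (T ^ l.get i) := by
        refine Submodule.span_le.2 ?_
        rintro _ ⟨k, rfl⟩
        simp only [SetLike.mem_coe, LinearMap.mem_ker, hf]
        rw [← Module.End.mul_apply, ← pow_add]
        exact pow_apply_eq_zero_of_le (h.pow_apply i) (by omega)
      exact this hx
    refine isIndecomposable_of_cyclic (g := g) (v := ⟨w i, hmem⟩) ?_ ?_
    · rw [hfin]
      ext x
      rw [coe_toRepresentation_sub_one_pow, hkill x x.2]
      rfl
    · rw [hfin, Ne, ← Submodule.coe_eq_zero, coe_toRepresentation_sub_one_pow]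
      exact h.linearIndependent.ne_zero ⟨i, ⟨l.get i - 1, by have := hpos i; omega⟩⟩

end Representations

/-- A sorted list of positive numbers is determined by the sums of its truncations. -/
lemma list_eq_of_sum_tsub_eq {l l' : List ℕ} (hl : l.SortedGE) (hl' : l'.SortedGE)
    (hpos : ∀ i, 1 ≤ l.get i) (hpos' : ∀ i, 1 ≤ l'.get i)
    (h : ∀ k, ∑ i, (l.get i - k) = ∑ i, (l'.get i - k)) : l = l' := by
  refine List.Perm.eq_of_sortedGE hl hl' (List.perm_iff_count.2 fun x => ?_)
  -- The multiplicity of `x` is the second difference at `x` of the truncated sums; `1 ≤ x` keeps `x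
  -- - 1` honest.
  have key : ∀ l : List ℕ, ∀ x, 1 ≤ x → l.count x + 2 * ∑ i, (l.get i - x)
      = ∑ i, (l.get i - (x - 1)) + ∑ i, (l.get i - (x + 1)) := by
    intro l x hx
    induction l with
    | nil => simp
    | cons y l ih =>
      have hs : ∀ k, ∑ i, ((y :: l).get i - k) = (y - k) + ∑ i, (l.get i - k) :=
        fun k => Fin.sum_univ_succ _
      rw [hs, hs, hs, List.count_cons]
      simp only [beq_iff_eq]
      split_ifs with hyx <;> omega
  rcases Nat.eq_zero_or_pos x with rfl | hx
  · rw [List.count_eq_zero_of_not_mem, List.count_eq_zero_of_not_mem]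
    · intro h0
      obtain ⟨i, hi⟩ := List.get_of_mem h0
      have := hpos' i
      omega
    · intro h0
      obtain ⟨i, hi⟩ := List.get_of_mem h0
      have := hpos i
      omega
  · have h1 := key l x hx
    have h2 := key l' x hx
    rw [h, h, h] at h1
    omega

/-! ### The Jordan type of `x + y` on `K[x, y] / (x ^ m, y ^ n)` -/

section Bicyclic

variable {K M : Type*} [Field K] [AddCommGroup M] [Module K M]

/-- `M` is isomorphic to `K[x, y] / (x ^ m, y ^ n)` as a module over `K[X, Y]`, with `u`
corresponding to `1`. -/
structure IsBicyclic (X Y : Module.End K M) (u : M) (m n : ℕ) : Prop where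
  comm : Commute X Y
  left : (X ^ m) u = 0
  right : (Y ^ n) u = 0
  linearIndependent :
    LinearIndependent K fun x : Fin m × Fin n => (X ^ (x.1 : ℕ) * Y ^ (x.2 : ℕ)) u
  span_eq_top :
    Submodule.span K (Set.range fun x : Fin m × Fin n => (X ^ (x.1 : ℕ) * Y ^ (x.2 : ℕ)) u) = ⊤

namespace IsBicyclic

variable {X Y : Module.End K M} {u : M} {m n : ℕ}

lemma monomial_eq_zero_left (h : IsBicyclic X Y u m n)
    {a : ℕ} (ha : m ≤ a) (b : ℕ) : (X ^ a * Y ^ b) u = 0 := by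
  rw [(h.comm.pow_pow a b).eq, Module.End.mul_apply, pow_apply_eq_zero_of_le h.left ha, map_zero]

lemma monomial_eq_zero_right (h : IsBicyclic X Y u m n)
    (a : ℕ) {b : ℕ} (hb : n ≤ b) : (X ^ a * Y ^ b) u = 0 := by
  rw [Module.End.mul_apply, pow_apply_eq_zero_of_le h.right hb, map_zero]

lemma add_pow_apply (h : IsBicyclic X Y u m n) (N a b : ℕ) : ((X + Y) ^ N) ((X ^ a * Y ^ b) u)
    = ∑ k ∈ Finset.range (N + 1), (N.choose k : K) • (X ^ (k + a) * Y ^ (N - k + b)) u := by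
  rw [h.comm.add_pow, LinearMap.sum_apply]
  refine Finset.sum_congr rfl fun k _ => ?_
  rw [← Module.End.mul_apply, ← nsmul_eq_mul', ← Nat.cast_smul_eq_nsmul K, smul_mul_assoc,
    LinearMap.smul_apply, pow_add, pow_add, mul_assoc, mul_assoc, ← mul_assoc (Y ^ (N - k)),
    ((h.comm.symm.pow_pow (N - k) a)).eq, mul_assoc]

lemma add_pow_apply_eq_sum (h : IsBicyclic X Y u m n)
    {r : ℕ} (hrm : r ≤ m) (hrn : r ≤ n) {j : ℕ} (hj : j < r) :
    ((X + Y) ^ (m - r + (n - r) + j)) ((Y ^ (r - 1 - j)) u) = ∑ i ∈ Finset.range r,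
      (((m - r + (n - r) + j).choose (m - r + i) : ℕ) : K)
        • (X ^ (m - r + i) * Y ^ (n - 1 - i)) u := by
  have h1 := h.add_pow_apply (m - r + (n - r) + j) 0 (r - 1 - j)
  rw [pow_zero, one_mul] at h1
  have h2 := Finset.sum_Ico_eq_sum_range (fun k => (((m - r + (n - r) + j).choose k : ℕ) : K)
        • (X ^ k * Y ^ (m - r + (n - 1) - k)) u) (m - r) (m - r + r)
  simp only [Nat.add_sub_cancel_left, Nat.add_sub_add_left] at h2
  rw [h1, ← h2]
  refine Finset.sum_congr_of_eq_on_inter ?_ ?_ ?_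
  · intro k hk hk'
    rw [Finset.mem_range] at hk
    rw [Finset.mem_Ico] at hk'
    rcases lt_or_ge k (m - r) with hlt | hge
    · rw [h.monomial_eq_zero_right _ (by omega), smul_zero]
    · rw [h.monomial_eq_zero_left (by omega), smul_zero]
  · intro k hk hk'
    rw [Finset.mem_range] at hk'
    rw [Nat.choose_eq_zero_of_lt (by omega), Nat.cast_zero, zero_smul]
  · intro k hk hk'
    rw [Finset.mem_range] at hk
    rw [Finset.mem_Ico] at hk'
    rw [add_zero, show m - r + (n - r) + j - k + (r - 1 - j) = m - r + (n - 1) - k by omega]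

/-- This is the degree `r - 1` to degree `m + n - r - 1` map, with source basis `(X + Y) ^ j Y ^ (r
- 1 - j)` and monomial target basis; the source basis is chosen to make the entries single
binomials. -/
lemma add_pow_sum_apply (h : IsBicyclic X Y u m n)
    {r : ℕ} (hrm : r ≤ m) (hrn : r ≤ n) (c : Fin r → K) :
    ((X + Y) ^ (m - r + (n - r))) (∑ j, c j • ((X + Y) ^ (j : ℕ)) ((Y ^ (r - 1 - j)) u))
      = ∑ i : Fin r, (((boxMatrix r (m - r) (n - r)).map (Int.castRingHom K)).mulVec c) i
        • (X ^ (m - r + i) * Y ^ (n - 1 - i)) u := by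
  have h1 : ∀ j : Fin r, ((X + Y) ^ (m - r + (n - r))) (((X + Y) ^ (j : ℕ)) ((Y ^ (r - 1 - j)) u))
      = ∑ i : Fin r, ((boxMatrix r (m - r) (n - r)).map (Int.castRingHom K)) i j
        • (X ^ (m - r + i) * Y ^ (n - 1 - i)) u := fun j => by
    rw [← Module.End.mul_apply, ← pow_add, h.add_pow_apply_eq_sum hrm hrn j.2, Finset.sum_range]
    simp [boxMatrix]
  simp only [map_sum, map_smul, h1, Finset.smul_sum, Matrix.mulVec, dotProduct, Finset.sum_smul,
    smul_smul]
  rw [Finset.sum_comm]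
  simp only [mul_comm]

/-- The alternating sum is killed by `X + Y`: the product telescopes to terms containing `X ^ m` or
`Y ^ n`. An invertible matrix makes it an image under the power. -/
lemma exists_chain_generator (h : IsBicyclic X Y u m n) {r : ℕ} (hrm : r ≤ m) (hmn : m ≤ n)
    (hdet : ((boxMatrix r (m - r) (n - r)).det : K) ≠ 0) :
    ∃ w, ((X + Y) ^ (m - r + (n - r) + 1)) w = 0 ∧ ((X + Y) ^ (m - r + (n - r))) w
      = ∑ i ∈ Finset.range r, (-1 : K) ^ i • (X ^ (m - r + i) * Y ^ (n - 1 - i)) u := by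
  set A := (boxMatrix r (m - r) (n - r)).map (Int.castRingHom K) with hA
  have hAdet : IsUnit A.det := by
    rw [hA, ← RingHom.mapMatrix_apply, ← RingHom.map_det]
    exact isUnit_iff_ne_zero.2 hdet
  have hw := h.add_pow_sum_apply hrm (hrm.trans hmn) (A⁻¹.mulVec fun i => (-1 : K) ^ (i : ℕ))
  rw [← hA, Matrix.mulVec_mulVec, Matrix.mul_nonsing_inv _ hAdet, Matrix.one_mulVec,
    ← Finset.sum_range fun i => (-1 : K) ^ i • (X ^ (m - r + i) * Y ^ (n - 1 - i)) u] at hw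
  refine ⟨_, ?_, hw⟩
  rw [pow_succ', Module.End.mul_apply, hw, map_sum]
  have hstep : ∀ i ∈ Finset.range r,
      (X + Y) ((-1 : K) ^ i • (X ^ (m - r + i) * Y ^ (n - 1 - i)) u)
        = (-1 : K) ^ i • (X ^ (m - r + i) * Y ^ (n - i)) u
          - (-1 : K) ^ (i + 1) • (X ^ (m - r + (i + 1)) * Y ^ (n - (i + 1))) u := by
    intro i hi
    rw [Finset.mem_range] at hi
    have hX : X ((X ^ (m - r + i) * Y ^ (n - 1 - i)) u)
        = (X ^ (m - r + (i + 1)) * Y ^ (n - (i + 1))) u := by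
      rw [← Module.End.mul_apply, ← mul_assoc, ← pow_succ', show n - 1 - i = n - (i + 1) by omega,
        add_assoc]
    have hY : Y ((X ^ (m - r + i) * Y ^ (n - 1 - i)) u) = (X ^ (m - r + i) * Y ^ (n - i)) u := by
      rw [← Module.End.mul_apply, ← mul_assoc, (h.comm.symm.pow_right _).eq, mul_assoc, ← pow_succ',
        show n - 1 - i + 1 = n - i by omega]
    rw [map_smul, LinearMap.add_apply, hX, hY, pow_succ, smul_add]
    simp [add_comm]
  rw [Finset.sum_congr rfl hstep, Finset.sum_range_sub' fun i =>
    (-1 : K) ^ i • (X ^ (m - r + i) * Y ^ (n - i)) u]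
  rw [h.monomial_eq_zero_right _ (b := n - 0) (by omega),
    h.monomial_eq_zero_left (a := m - r + r) (by omega)]
  simp

lemma finiteDimensional (h : IsBicyclic X Y u m n) : FiniteDimensional K M :=
  Module.Finite.of_basis (Module.Basis.mk h.linearIndependent h.span_eq_top.ge)

lemma finrank_eq (h : IsBicyclic X Y u m n) : Module.finrank K M = m * n := by
  rw [Module.finrank_eq_card_basis (Module.Basis.mk h.linearIndependent h.span_eq_top.ge)]
  simp

/-- Only the term `k = 0` contains `Y ^ (n - 1)`, and its `X`-exponent depends on `i`; those
coordinates form a dual family. -/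
lemma linearIndependent_socle (h : IsBicyclic X Y u m n)
    (hmn : m ≤ n) : LinearIndependent K fun i : Fin m =>
    ∑ k ∈ Finset.range (i + 1), (-1 : K) ^ k • (X ^ (m - (i + 1) + k) * Y ^ (n - 1 - k)) u := by
  let B := Module.Basis.mk h.linearIndependent h.span_eq_top.ge
  have hcoord : ∀ (a b : ℕ) (hb : b < n) (a' b' : ℕ) (ha' : a' < m) (hb' : b' < n), a < m →
      B.coord (⟨a', ha'⟩, ⟨b', hb'⟩) ((X ^ a * Y ^ b) u) = if a = a' ∧ b = b' then 1 else 0 := by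
    intro a b hb a' b' ha' hb' ha
    have : (X ^ a * Y ^ b) u = B (⟨a, ha⟩, ⟨b, hb⟩) := by simp [B]
    rw [this, Module.Basis.coord_apply, Module.Basis.repr_self, Finsupp.single_apply]
    simp
  let top : Fin m → Fin m × Fin n := fun i =>
    (⟨m - (i + 1), by have := i.2; omega⟩, ⟨n - 1, by have := i.2; omega⟩)
  have hval : ∀ i j : Fin m, B.coord (top i)
      (∑ k ∈ Finset.range (j + 1), (-1 : K) ^ k • (X ^ (m - (j + 1) + k) * Y ^ (n - 1 - k)) u)
      = if i = j then 1 else 0 := by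
    intro i j
    have hj := j.2
    rw [map_sum, Finset.sum_eq_single 0]
    · rw [map_smul, hcoord (m - (j + 1) + 0) (n - 1 - 0) (by omega) (m - (i + 1)) (n - 1) (by omega)
        (by omega) (by omega)]
      simp only [Fin.ext_iff, pow_zero, one_smul]
      congr 1
      simp only [eq_iff_iff]
      omega
    · intro k hk hk0
      rw [Finset.mem_range] at hk
      rw [map_smul, hcoord (m - (j + 1) + k) (n - 1 - k) (by omega) (m - (i + 1)) (n - 1)
        (by omega) (by omega) (by omega), if_neg (by omega), smul_zero]
    · simp
  refine LinearIndependent.of_pairwise_dual_eq_zero_one _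
    (fun i : Fin m => B.coord (top i)) ?_ ?_
  · intro i j hij
    change B.coord _ _ = _
    rw [hval, if_neg hij]
  · intro i
    rw [hval, if_pos rfl]

lemma exists_isJordanBasis (h : IsBicyclic X Y u m n) (hmn : m ≤ n)
    (hdet : ∀ r, 1 ≤ r → r ≤ m → ((boxMatrix r (m - r) (n - r)).det : K) ≠ 0) :
    ∃ w : Fin m → M, IsJordanBasis (X + Y) (fun i : Fin m => m + n - 1 - 2 * i) w := by
  choose w hw0 hw using fun i : Fin m =>
    h.exists_chain_generator (r := i + 1) i.2 hmn (hdet _ (by omega) i.2)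
  have hd : ∀ i : Fin m, m + n - 1 - 2 * i = m - (i + 1) + (n - (i + 1)) + 1 := fun i => by omega
  simp only [hd]
  have hli := linearIndependent_chains hw0 (by
    simp only [Nat.add_sub_cancel, hw]
    exact h.linearIndependent_socle hmn)
  have := h.finiteDimensional
  refine ⟨w, hw0, hli, ?_⟩
  refine hli.span_eq_top_of_card_eq_finrank' ?_
  rw [h.finrank_eq, Fintype.card_sigma]
  simp only [Fintype.card_fin]
  -- The chain lengths must total `m * n`; the square stands on the left to avoid subtraction.
  have : ∀ k ≤ m,
      ∑ i ∈ Finset.range k, (m - (i + 1) + (n - (i + 1)) + 1) + k * k = k * (m + n) := by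
    intro k hk
    induction k with
    | zero => simp
    | succ k ih =>
      have := ih (by omega)
      rw [Finset.sum_range_succ]
      zify [show k + 1 ≤ m by omega, show k + 1 ≤ n by omega] at this ⊢
      linarith
  have := this m le_rfl
  rw [Finset.sum_range] at this
  rw [mul_add] at this
  omega

/-- Degrees below `r - 1` give at most `r (r - 1) / 2` images, degree `r - 1` gives rank at most `r
- 1` by singularity, and higher degrees land among the `r (r - 1) / 2` top monomials: `r ^ 2 - 1` in
all. -/
lemma finrank_range_lt (h : IsBicyclic X Y u m n) {r : ℕ} (hr : 1 ≤ r) (hrm : r ≤ m) (hmn : m ≤ n)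
    (hdet : ((boxMatrix r (m - r) (n - r)).det : K) = 0) :
    Module.finrank K (LinearMap.range ((X + Y) ^ (m - r + (n - r)))) < r * r := by
  have := h.finiteDimensional
  set s := m - r + (n - r) with hs
  set L := X + Y with hL
  let Φ : (Fin r → K) →ₗ[K] M :=
    (L ^ s) ∘ₗ Fintype.linearCombination K fun j : Fin r => (L ^ (j : ℕ)) ((Y ^ (r - 1 - j)) u)
  have hΦ : Module.finrank K (LinearMap.range Φ) + 1 ≤ r := by
    have hdet' : ((boxMatrix r (m - r) (n - r)).map (Int.castRingHom K)).det = 0 := by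
      rw [← RingHom.mapMatrix_apply, ← RingHom.map_det]
      exact hdet
    obtain ⟨c, hc0, hc⟩ := Matrix.exists_mulVec_eq_zero_iff.2 hdet'
    have hker : c ∈ LinearMap.ker Φ := by
      rw [LinearMap.mem_ker, LinearMap.comp_apply, Fintype.linearCombination_apply, hL, hs,
        h.add_pow_sum_apply hrm (hrm.trans hmn), hc]
      simp
    have hpos : 0 < Module.finrank K (LinearMap.ker Φ) := by
      rw [Module.finrank_pos_iff, Submodule.nontrivial_iff_ne_bot, Submodule.ne_bot_iff]
      exact ⟨c, hker, hc0⟩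
    have := LinearMap.finrank_range_add_finrank_ker Φ
    rw [Module.finrank_fin_fun] at this
    omega
  let low : ((d : Fin (r - 1)) × Fin (d + 1)) → M := fun x =>
    (L ^ s) ((L ^ (x.2 : ℕ)) ((Y ^ (x.1 - x.2 : ℕ)) u))
  let high : ((d : Fin (r - 1)) × Fin (d + 1)) → M := fun x =>
    (X ^ (m - 1 - x.2) * Y ^ (n - 1 - (x.1 - x.2))) u
  have hcard : 2 * Fintype.card ((d : Fin (r - 1)) × Fin (d + 1)) = (r - 1) * r := by
    rw [Fintype.card_sigma]
    simp only [Fintype.card_fin]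
    rw [← Finset.sum_range fun i => i + 1]
    have : ∀ k, 2 * ∑ i ∈ Finset.range k, (i + 1) = k * (k + 1) := by
      intro k
      induction k with
      | zero => simp
      | succ k ih => rw [Finset.sum_range_succ, mul_add, ih]; ring
    rw [this, Nat.sub_add_cancel hr]
  have hle : LinearMap.range (L ^ s) ≤ Submodule.span K (Set.range low) ⊔
      (LinearMap.range Φ ⊔ Submodule.span K (Set.range high)) := by
    rw [LinearMap.range_eq_map, ← h.span_eq_top, Submodule.map_span, Submodule.span_le]
    rintro _ ⟨_, ⟨⟨a, b⟩, rfl⟩, rfl⟩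
    simp only [SetLike.mem_coe]
    rcases lt_or_ge ((a : ℕ) + b) r with hab | hab
    · have hexp : (X ^ (a : ℕ) * Y ^ (b : ℕ)) u = ∑ k ∈ Finset.range (a + 1),
          (((-1) ^ (a - k : ℕ) * ((a : ℕ).choose k) : ℤ) : K) • (L ^ k) ((Y ^ (a + b - k : ℕ)) u) := by
        have hcomm : Commute L Y := h.comm.add_left (Commute.refl Y)
        rw [show X = L + -Y by rw [hL]; abel, hcomm.neg_right.add_pow, Finset.sum_mul,
          LinearMap.sum_apply]
        refine Finset.sum_congr rfl fun k hk => ?_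
        rw [Finset.mem_range] at hk
        rw [Int.cast_smul_eq_zsmul, neg_pow, show (a + b - k : ℕ) = (a - k) + b by omega, pow_add Y]
        rw [← nsmul_eq_mul', smul_mul_assoc, mul_assoc, mul_assoc, ← Module.End.mul_apply]
        rcases Nat.even_or_odd ((a : ℕ) - k) with he | ho
        · simp [he.neg_one_pow]
        · simp [ho.neg_one_pow]
      rw [hexp, map_sum]
      refine sum_mem fun k hk => ?_
      rw [Finset.mem_range] at hk
      rw [map_smul]
      refine Submodule.smul_mem _ _ ?_
      rcases lt_or_ge ((a : ℕ) + b) (r - 1) with hlt | hge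
      · refine Submodule.mem_sup_left (Submodule.subset_span ?_)
        exact ⟨⟨⟨a + b, hlt⟩, ⟨k, by simp only; omega⟩⟩, rfl⟩
      · refine Submodule.mem_sup_right (Submodule.mem_sup_left ?_)
        refine ⟨Pi.single ⟨k, by omega⟩ 1, ?_⟩
        rw [LinearMap.comp_apply, Fintype.linearCombination_apply_single, one_smul]
        simp only
        rw [show (a + b - k : ℕ) = r - 1 - k by omega]
    · refine Submodule.mem_sup_right (Submodule.mem_sup_right ?_)
      rw [hL, h.add_pow_apply]
      refine sum_mem fun k hk => Submodule.smul_mem _ _ ?_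
      rw [Finset.mem_range] at hk
      by_cases h1 : m ≤ k + a
      · rw [h.monomial_eq_zero_left h1]
        exact zero_mem _
      by_cases h2 : n ≤ s - k + b
      · rw [h.monomial_eq_zero_right _ h2]
        exact zero_mem _
      refine Submodule.subset_span
        ⟨⟨⟨(m - 1 - (k + a)) + (n - 1 - (s - k + b)), by omega⟩, ⟨m - 1 - (k + a), ?_⟩⟩, ?_⟩
      · simp only; omega
      · simp only [high]
        congr 3 <;> omega
  have h1 := (Submodule.finrank_mono hle).trans (Submodule.finrank_add_le_finrank_add_finrank _ _)
  have h2 := Submodule.finrank_add_le_finrank_add_finrank (LinearMap.range Φ)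
    (Submodule.span K (Set.range high))
  have h3 : Module.finrank K (Submodule.span K (Set.range low)) ≤ _ := finrank_range_le_card low
  have h4 : Module.finrank K (Submodule.span K (Set.range high)) ≤ _ := finrank_range_le_card high
  obtain ⟨r, rfl⟩ : ∃ r', r = r' + 1 := ⟨r - 1, by omega⟩
  simp only [Nat.add_sub_cancel] at hcard h3 h4
  have : (r + 1) * (r + 1) = r * (r + 1) + r + 1 := by ring
  omega

end IsBicyclic

end Bicyclic

/-! ### From the tensor product to the criterion -/

lemma isBicyclic_tensorProduct {K V W : Type*} [Field K] [AddCommGroup V] [Module K V]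
    [AddCommGroup W] [Module K W] {N : Module.End K V} {N' : Module.End K W} {v : V} {w : W}
    {m n : ℕ} (hm : Module.finrank K V = m) (hn : Module.finrank K W = n) (hm0 : 0 < m)
    (hn0 : 0 < n) (hN : N ^ m = 0) (hN' : N' ^ n = 0) (hv : (N ^ (m - 1)) v ≠ 0)
    (hw : (N' ^ (n - 1)) w ≠ 0) :
    IsBicyclic (TensorProduct.map N 1) (TensorProduct.map 1 N') (v ⊗ₜ[K] w) m n := by
  have : Nonempty (Fin m) := ⟨⟨0, hm0⟩⟩
  have : Nonempty (Fin n) := ⟨⟨0, hn0⟩⟩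
  let b := basisOfLinearIndependentOfCardEqFinrank
    (linearIndependent_chain (by rw [hN]; rfl) hv) (by rw [hm, Fintype.card_fin])
  let b' := basisOfLinearIndependentOfCardEqFinrank
    (linearIndependent_chain (by rw [hN']; rfl) hw) (by rw [hn, Fintype.card_fin])
  have hb : ⇑(b.tensorProduct b') = fun x : Fin m × Fin n =>
      ((TensorProduct.map N 1 : Module.End K (V ⊗[K] W)) ^ (x.1 : ℕ)
        * (TensorProduct.map 1 N' : Module.End K (V ⊗[K] W)) ^ (x.2 : ℕ)) (v ⊗ₜ[K] w) := by
    ext ⟨i, j⟩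
    simp [b, b', Module.Basis.tensorProduct_apply, TensorProduct.map_pow]
  refine ⟨?_, ?_, ?_, hb ▸ (b.tensorProduct b').linearIndependent,
    hb ▸ (b.tensorProduct b').span_eq⟩
  · rw [Commute, SemiconjBy, ← TensorProduct.map_mul, ← TensorProduct.map_mul]
    simp
  · rw [TensorProduct.map_pow, hN]
    simp
  · rw [TensorProduct.map_pow, hN']
    simp

/-- The substitution `x ↦ x (1 + y)` is an automorphism of `K[x, y] / (x ^ m, y ^ n)`. -/
lemma IsBicyclic.twist {K M : Type*} [Field K] [AddCommGroup M] [Module K M]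
    {X Y : Module.End K M} {u : M} {m n : ℕ} (h : IsBicyclic X Y u m n) :
    IsBicyclic (X * (1 + Y)) Y u m n := by
  have hfd := h.finiteDimensional
  have hcX : Commute X (1 + Y) := (Commute.one_right X).add_right h.comm
  have hcY : Commute Y (1 + Y) := (Commute.one_right Y).add_right (Commute.refl Y)
  have hcomm : Commute (X * (1 + Y)) Y := h.comm.mul_left hcY.symm
  have hX : ((X * (1 + Y)) ^ m) u = 0 := by
    rw [hcX.mul_pow, (hcX.pow_pow m m).eq, Module.End.mul_apply, h.left, map_zero]
  have hYn : Y ^ n = 0 := by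
    refine LinearMap.ext_on h.span_eq_top ?_
    rintro _ ⟨⟨a, b⟩, rfl⟩
    simp only [LinearMap.zero_apply]
    rw [← Module.End.mul_apply, ← mul_assoc, (h.comm.symm.pow_pow n a).eq, mul_assoc, ← pow_add,
      h.monomial_eq_zero_right _ (by omega)]
  set f := fun x : Fin m × Fin n => ((X * (1 + Y)) ^ (x.1 : ℕ) * Y ^ (x.2 : ℕ)) u with hf
  set S := Submodule.span K (Set.range f) with hS
  have hmem : ∀ a b : ℕ, ((X * (1 + Y)) ^ a * Y ^ b) u ∈ S := by
    intro a b
    by_cases ha : m ≤ a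
    · rw [(hcomm.pow_pow a b).eq, Module.End.mul_apply, pow_apply_eq_zero_of_le hX ha, map_zero]
      exact zero_mem _
    by_cases hb : n ≤ b
    · rw [Module.End.mul_apply, pow_apply_eq_zero_of_le h.right hb, map_zero]
      exact zero_mem _
    exact Submodule.subset_span ⟨(⟨a, by omega⟩, ⟨b, by omega⟩), rfl⟩
  have hSX : ∀ x ∈ S, (X * (1 + Y)) x ∈ S := by
    have : S ≤ S.comap (X * (1 + Y)) := by
      refine Submodule.span_le.2 ?_
      rintro _ ⟨⟨a, b⟩, rfl⟩
      simp only [Submodule.comap_coe, Set.mem_preimage, SetLike.mem_coe, hf]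
      rw [← Module.End.mul_apply, ← mul_assoc, ← pow_succ']
      exact hmem _ _
    exact fun x hx => this hx
  have hSY : ∀ x ∈ S, Y x ∈ S := by
    have : S ≤ S.comap Y := by
      refine Submodule.span_le.2 ?_
      rintro _ ⟨⟨a, b⟩, rfl⟩
      simp only [Submodule.comap_coe, Set.mem_preimage, SetLike.mem_coe, hf]
      rw [← Module.End.mul_apply, ← mul_assoc, (hcomm.symm.pow_right a).eq, mul_assoc, ← pow_succ']
      exact hmem _ _
    exact fun x hx => this hx
  have hSYk : ∀ x ∈ S, ∀ k, (Y ^ k) x ∈ S := by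
    intro x hx k
    induction k with
    | zero => simpa
    | succ k ih => rw [pow_succ', Module.End.mul_apply]; exact hSY _ ih
  -- `Y` is nilpotent, so a geometric series inverts `1 + Y`; hence `S` is stable under `X` as well.
  have hinv : (1 + Y) * ∑ k ∈ Finset.range n, (-Y) ^ k = 1 := by
    have := mul_neg_geom_sum (-Y) n
    rwa [neg_pow, hYn, mul_zero, sub_zero, sub_neg_eq_add] at this
  have hSX' : ∀ x ∈ S, X x ∈ S := by
    intro x hx
    have : X x = (X * (1 + Y)) ((∑ k ∈ Finset.range n, (-Y) ^ k) x) := by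
      rw [← Module.End.mul_apply, mul_assoc, hinv, mul_one]
    rw [this]
    refine hSX _ ?_
    rw [LinearMap.sum_apply]
    refine sum_mem fun k _ => ?_
    rcases Nat.even_or_odd k with hk | hk
    · rw [hk.neg_pow]
      exact hSYk x hx k
    · rw [hk.neg_pow]
      exact neg_mem (hSYk x hx k)
  have hspan : S = ⊤ := by
    rw [eq_top_iff, ← h.span_eq_top, Submodule.span_le]
    rintro _ ⟨⟨a, b⟩, rfl⟩
    simp only [SetLike.mem_coe]
    generalize (a : ℕ) = a
    induction a with
    | zero => simpa using hmem 0 b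
    | succ a ih => rw [pow_succ', mul_assoc, Module.End.mul_apply]; exact hSX' _ ih
  refine ⟨hcomm, hX, h.right, ?_, hspan⟩
  refine linearIndependent_of_top_le_span_of_card_eq_finrank hspan.ge ?_
  rw [h.finrank_eq]
  simp

/-- The first `r` standard parts exceed `m + n - 2 r` by `2 r - 1, 2 r - 3, …, 1`; the others do not
exceed it. -/
lemma sum_standard_tsub {m n r : ℕ} (hrm : r ≤ m) (hmn : m ≤ n) :
    ∑ i ∈ Finset.range m, (m + n - 1 - 2 * i - (m - r + (n - r))) = r * r := by
  have h1 : ∀ k ≤ r, ∑ i ∈ Finset.range k, (m + n - 1 - 2 * i - (m - r + (n - r))) + k * k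
      = 2 * (k * r) := by
    intro k hk
    induction k with
    | zero => simp
    | succ k ih =>
      have := ih (by omega)
      rw [Finset.sum_range_succ]
      have h2 : m + n - 1 - 2 * k - (m - r + (n - r)) + 2 * k + 1 = 2 * r := by omega
      linarith
  have h2 : ∑ i ∈ Finset.range m, (m + n - 1 - 2 * i - (m - r + (n - r)))
      = ∑ i ∈ Finset.range r, (m + n - 1 - 2 * i - (m - r + (n - r))) := by
    symm
    refine Finset.sum_subset (Finset.range_mono hrm) fun i _ hi => ?_
    rw [Finset.mem_range] at hi
    omega
  have := h1 r le_rfl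
  rw [h2]
  omega

lemma exists_isJordanBasis_list {K M : Type*} [Field K] [AddCommGroup M] [Module K M]
    {T : Module.End K M} {m : ℕ} {d : Fin m → ℕ} {l : List ℕ} (hl : l.length = m)
    (hd : ∀ i, l.get i = d (Fin.cast hl i)) (h : ∃ w, IsJordanBasis T d w) :
    ∃ w, IsJordanBasis T l.get w := by
  subst hl
  obtain rfl : l.get = d := funext hd
  exact h

lemma IsStandard.sum_tsub {m n : ℕ} {l : List ℕ} (hl : IsStandard m n l) (k : ℕ) :
    ∑ i, (l.get i - k) = ∑ i ∈ Finset.range m, (m + n - 1 - 2 * i - k) := by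
  obtain ⟨rfl, h⟩ := hl
  rw [Finset.sum_range]
  refine Finset.sum_congr rfl fun i _ => ?_
  have := h i i.2
  rw [List.get_eq_getElem]
  omega

lemma isStandard_ofFn {m n : ℕ} (hmn : m ≤ n) :
    IsStandard m n (List.ofFn fun i : Fin m => m + n - 1 - 2 * (i : ℕ)) := by
  refine ⟨List.length_ofFn, fun i hi => ?_⟩
  rw [List.getElem_ofFn]
  rw [List.length_ofFn] at hi
  push_cast
  omega

/-- The Jordan partition is standard if and only if the binomial determinants do not vanish. -/
lemma isStandard_indecomposableDims_iff {K G M : Type*} [Field K] [Group G] [AddCommGroup M]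
    [Module K M] {τ : Representation K G M} {g : G} {p a : ℕ} [Fact p.Prime] [CharP K p]
    (hG : Nat.card G = p ^ a) (hg : ∀ x, x ∈ Subgroup.zpowers g) {X Y : Module.End K M} {u : M}
    {m n : ℕ} (h : IsBicyclic X Y u m n) (hT : τ g - 1 = X + Y) (hm : 1 ≤ m) (hmn : m ≤ n) :
    IsStandard m n (indecomposableDims τ) ↔
      ∀ r, 1 ≤ r → r ≤ m → ((boxMatrix r (m - r) (n - r)).det : K) ≠ 0 := by
  have := h.finiteDimensional
  have : Finite G := Nat.finite_of_card_ne_zero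
    (by rw [hG]; exact pow_ne_zero _ (Fact.out : p.Prime).ne_zero)
  constructor
  · intro hst r hr hrm hdet
    have hdec : HasDecomposition τ (indecomposableDims τ) := by
      -- The default `[]` is not standard because `1 ≤ m`.
      by_cases hex : ∃ l : List ℕ, l.SortedGE ∧ HasDecomposition τ l
      · rw [indecomposableDims, dif_pos hex]
        exact hex.choose_spec.2
      · have := hst.1
        rw [indecomposableDims, dif_neg hex] at this
        simp at this
        omega
    obtain ⟨-, w, hw⟩ := hdec.exists_isJordanBasis hG hg
    have h1 := hw.finrank_range_pow (m - r + (n - r))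
    rw [hst.sum_tsub, sum_standard_tsub hrm hmn, hT] at h1
    exact (h.finrank_range_lt hr hrm hmn hdet).ne h1
  · intro hdet
    have hst := isStandard_ofFn hmn
    set l := List.ofFn fun i : Fin m => m + n - 1 - 2 * (i : ℕ) with hl
    obtain ⟨w, hw⟩ := exists_isJordanBasis_list (l := l) hst.1
      (fun i => by rw [List.get_ofFn]) (h.exists_isJordanBasis hmn hdet)
    rw [← hT] at hw
    have hpos : ∀ i, 1 ≤ l.get i := fun i => by
      have := i.2.trans_eq hst.1
      rw [List.get_ofFn, Fin.val_cast]
      omega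
    have hsorted : l.SortedGE := by
      rw [hl, List.sortedGE_ofFn_iff]
      intro i j hij
      have : (i : ℕ) ≤ j := hij
      simp only
      omega
    have hex : ∃ l : List ℕ, l.SortedGE ∧ HasDecomposition τ l :=
      ⟨l, hsorted, hw.hasDecomposition hg hpos⟩
    rw [indecomposableDims, dif_pos hex]
    obtain ⟨hpos', w', hw'⟩ := hex.choose_spec.2.exists_isJordanBasis hG hg
    -- Ranks of powers of `τ g - 1` determine the block sizes, so the chosen list is `l`; this
    -- replaces Krull–Schmidt.
    rw [list_eq_of_sum_tsub_eq hex.choose_spec.1 hsorted hpos' hpos fun k => by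
      rw [← hw'.finrank_range_pow, ← hw.finrank_range_pow]]
    exact hst

end JordanPartition

theorem theorem2 {p : ℕ} (hp : p.Prime) (hp2 : p ≠ 2)
    {K : Type*} [Field K] [CharP K p]
    {G : Type*} [Group G] [IsCyclic G] {a : ℕ} (hG : Nat.card G = p ^ a)
    {V W : Type*} [AddCommGroup V] [Module K V] [AddCommGroup W] [Module K W]
    (ρ : Representation K G V) (σ : Representation K G W)
    (hρ : JordanPartition.IsIndecomposable ρ) (hσ : JordanPartition.IsIndecomposable σ)
    {m n t : ℕ} (hm : Module.finrank K V = m) (hn : Module.finrank K W = n)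
    (ht : 1 ≤ t) (hmt : p ^ t ≤ m) (hmt' : m < p ^ (t + 1)) (hmn : m ≤ n) :
    JordanPartition.IsStandard m n (JordanPartition.jordanPartition ρ σ) ↔
      (m, n) ∈ JordanPartition.standardPairs p t := by
  have := Fact.mk hp
  have hodd : Odd p := hp.odd_of_ne_two hp2
  have hp3 : 3 ≤ p := by have := hp.two_le; omega
  have hm0 : 0 < m := (pow_pos hp.pos t).trans_le hmt
  have : FiniteDimensional K V := Module.finite_of_finrank_pos (by omega)
  have : FiniteDimensional K W := Module.finite_of_finrank_pos (by omega)
  obtain ⟨g, hg⟩ := IsCyclic.exists_generator (α := G)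
  obtain ⟨hN, v, hv⟩ := hρ.exists_cyclic_vector hG hg
  obtain ⟨hN', w, hw⟩ := hσ.exists_cyclic_vector hG hg
  rw [hm] at hN hv
  rw [hn] at hN' hw
  have hB := (JordanPartition.isBicyclic_tensorProduct hm hn hm0 (hm0.trans_le hmn)
    hN hN' hv hw).twist
  -- Expansion of `(1 + N) ⊗ (1 + N') - 1`, where `N` and `N'` are `ρ g - 1` and `σ g - 1`.
  have hT : (ρ.tprod σ) g - 1 = TensorProduct.map (ρ g - 1) 1 * (1 + TensorProduct.map 1 (σ g - 1))
      + TensorProduct.map 1 (σ g - 1) := by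
    refine TensorProduct.ext' fun x y => ?_
    simp [TensorProduct.tmul_sub, TensorProduct.sub_tmul]
  rw [JordanPartition.jordanPartition,
    JordanPartition.isStandard_indecomposableDims_iff hG hg hB hT hm0 hmn,
    ← JordanPartition.forall_boxExcess_eq_zero_iff hodd hp3 ht hmt hmt' hmn]
  constructor
  · intro h r e hr hrm he hpos
    exact h r hr hrm ((CharP.intCast_eq_zero_iff K p _).2
      ((JordanPartition.prime_dvd_det_boxMatrix_iff hp _ _ _).2 ⟨e, he, hpos⟩))
  · intro h r hr hrm hdet
    obtain ⟨e, he, hpos⟩ := (JordanPartition.prime_dvd_det_boxMatrix_iff hp _ _ _).1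
      ((CharP.intCast_eq_zero_iff K p _).1 hdet)
    exact h r e hr hrm he hpos
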